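/- Let $k$ be a field and let $(Q,\mathcal P)$ be a thread quiver: a quiver $Q$ (possibly infinite, loops and multiple arrows allowed) together with a possibly empty linearly ordered set $\mathcal P_\alpha$ for every arrow $\alpha$. Its path category $\mathcal C$ is the $k$-linear category whose objects are the vertices of $Q$ and the points of the sets $\mathcal P_\alpha$, and whose Hom spaces have as basis the path-like elements: the $\eta_{y,x}$ for $x\le y$ in one $\mathcal P_\alpha$ (with $\eta_{x,x}$ the identity), and the $\eta_{y,s(\beta)}\,p\,\eta_{t(\alpha),x}$ for $x\in\mathcal P_\alpha$, $y\in\mathcal P_\beta$ and $p$ a path in $Q$ from $t(\alpha)$ to $s(\beta)$ (if $x$ or $y$ is a vertex of $Q$, the corresponding factor $\eta$ is absent and $p$ starts at $x$, respectively ends at $y$); composition is induced by concatenation of paths, $\eta_{z,y}\eta_{y,x}=\eta_{z,x}$ and $\eta_{t(\alpha),x}\eta_{x,s(\alpha)}=\alpha$. Let $\mathcal I$ be an ideal of $\mathcal C$ and $\mathcal A=\mathcal C/\mathcal I$. A pointwise finite-dimensional (pwf) representation of a $k$-linear category is a $k$-linear functor from it to finite-dimensional $k$-vector spaces. A representation of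 $\mathcal A$ is noise if it vanishes at all vertices of $Q$; it is noise free if it has no non-zero direct summand that is noise. For a pwf representation $Z$ of $\mathcal A$, let $\mathfrak P_Z$ be the partition of the set of objects in which every vertex of $Q$ is a cell on its own, points of different $\mathcal P_\alpha$ lie in different cells, and $x\le y$ in $\mathcal P_\alpha$ lie in the same cell if and only if $Z(\eta_{z,x})$ and $Z(\eta_{y,z})$ are isomorphisms for all $x\le z\le y$. A partition of the objects is valid if every vertex of $Q$ is a cell on its own and every $\mathcal P_\alpha$ is a union of finitely many cells, each of which is an interval (order-convex subset) of $\mathcal P_\alpha$. A sample of a partition is a set of objects that contains exactly one element of each cell. For a valid partition $\mathfrak P$, two morphisms $f_1\colon x_1\to y_1$ and $f_2\colon x_2\to y_2$ of $\mathcal C$, with $x_1,x_2$ in one cell $X$ and $y_1,y_2$ in one cell $Y$, are $\mathfrak P$-equivalent if $\eta_{w,y_1}f_1\eta_{x_1,z}=\eta_{w,y_2}f_2\eta_{x_2,z}$ for some $z\in X$, $w\in Y$ with $z\le x_1,x_2$ and $w\ge y_1,y_2$. Let $\overline{\mathcal I}^{\mathfrak P}$ be the ideal generated by all morphisms that are $\mathfrak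 P$-equivalent to a morphism of $\mathcal I$, and let $\overline{\mathcal A}^{\mathfrak P}=\mathcal C/\overline{\mathcal I}^{\mathfrak P}$, so that representations of $\overline{\mathcal A}^{\mathfrak P}$ are representations of $\mathcal A$. For a sample $\mathcal M$ of $\mathfrak P$, let $\overline{\mathcal A}^{\mathfrak P}(\mathcal M)$ be the full subcategory of $\overline{\mathcal A}^{\mathfrak P}$ on $\mathcal M$. Let $\mathbf r\colon\overline{\mathcal A}^{\mathfrak P}\to\overline{\mathcal A}^{\mathfrak P}(\mathcal M)$ be the functor that sends $x$ to the point $s_x\in\mathcal M$ of its cell and the class of $f\colon x\to y$ to the class of the morphism $s_x\to s_y$ that is $\mathfrak P$-equivalent to $f$, and let $\mathrm{Ind}_{\mathfrak P}=\mathbf r^*$, a functor from pwf representations of $\overline{\mathcal A}^{\mathfrak P}(\mathcal M)$ to pwf representations of $\overline{\mathcal A}^{\mathfrak P}$. Theorem. Let $Z$ be a noise free pwf representation of $\mathcal A$ and let $\mathcal M$ be a sample of $\mathfrak P=\mathfrak P_Z$. Then $\mathfrak P_Z$ is valid, and there is a family $(N_\lambda)_{\lambda\in\Lambda}$ of indecomposable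 pwf representations of $\overline{\mathcal A}^{\mathfrak P}(\mathcal M)$ such that every $\mathrm{Ind}_{\mathfrak P}(N_\lambda)$ is an indecomposable representation of $\mathcal A$ and $$Z\cong\bigoplus_{\lambda\in\Lambda}\mathrm{Ind}_{\mathfrak P}(N_\lambda).$$ This decomposition is unique up to isomorphism: if $Z\cong\bigoplus_{\mu\in\Lambda'}V_\mu$ with all $V_\mu$ indecomposable pwf representations of $\mathcal A$, then there is a bijection $\sigma\colon\Lambda\to\Lambda'$ with $\mathrm{Ind}_{\mathfrak P}(N_\lambda)\cong V_{\sigma(\lambda)}$ for all $\lambda$. If $\mathcal M$ is finite, then $\Lambda$ is finite. -/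

import Mathlib

open CategoryTheory CategoryTheory.Limits

universe w u v₁ u₁ u₂ u₃

noncomputable section

/-! ### Ideals of linear categories and quotients -/

/-- A (two-sided) ideal of a `k`-linear category: a subspace of every Hom space, stable under
composition on both sides. -/
structure CatIdeal (k : Type u₁) [Field k] (C : Type u₂) [Category.{v₁} C] [Preadditive C]
    [Linear k C] where
  carrier : ∀ X Y : C, Submodule k (X ⟶ Y)
  comp_left : ∀ {X Y Z : C} (f : X ⟶ Y) (g : Y ⟶ Z), g ∈ carrier Y Z → f ≫ g ∈ carrier X Z
  comp_right : ∀ {X Y Z : C} (f : X ⟶ Y) (g : Y ⟶ Z), f ∈ carrier X Y → f ≫ g ∈ carrier X Z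

namespace CatIdeal

variable {k : Type u₁} [Field k] {C : Type u₂} [Category.{v₁} C] [Preadditive C] [Linear k C]

/-- The ideal generated by a family of morphisms: the smallest ideal that contains it. -/
def generate (k : Type u₁) [Field k] {C : Type u₂} [Category.{v₁} C] [Preadditive C] [Linear k C]
    (S : ∀ X Y : C, Set (X ⟶ Y)) : CatIdeal k C where
  carrier X Y := ⨅ J : {J : CatIdeal k C // ∀ X Y, S X Y ⊆ J.carrier X Y}, J.1.carrier X Y
  comp_left f g h := by
    rw [Submodule.mem_iInf] at h ⊢
    exact fun J => J.1.comp_left f g (h J)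
  comp_right f g h := by
    rw [Submodule.mem_iInf] at h ⊢
    exact fun J => J.1.comp_right f g (h J)

theorem subset_generate (S : ∀ X Y : C, Set (X ⟶ Y)) {X Y : C} {f : X ⟶ Y} (hf : f ∈ S X Y) :
    f ∈ (generate k S).carrier X Y :=
  (Submodule.mem_iInf _).2 fun J => J.2 X Y hf

theorem mem_of_mem_generate {S : ∀ X Y : C, Set (X ⟶ Y)} {X Y : C} {f : X ⟶ Y}
    (hf : f ∈ (generate k S).carrier X Y) (J : CatIdeal k C)
    (hJ : ∀ X Y, S X Y ⊆ J.carrier X Y) : f ∈ J.carrier X Y :=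
  (Submodule.mem_iInf _).1 hf ⟨J, hJ⟩

/-- Two parallel morphisms are identified when their difference lies in the ideal. -/
def rel (I : CatIdeal k C) : HomRel C := fun {X Y} f g => f - g ∈ I.carrier X Y

instance (I : CatIdeal k C) : Congruence I.rel where
  equivalence :=
    { refl := fun f => by simp [rel]
      symm := fun {f g} h => by
        have := (I.carrier _ _).neg_mem h
        simpa [rel] using this
      trans := fun {f g h} h₁ h₂ => by
        have := (I.carrier _ _).add_mem h₁ h₂
        simpa [rel] using this }
  comp_left f g g' h := by
    have := I.comp_left f _ h
    simpa [rel, Preadditive.comp_sub] using this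
  comp_right g h := by
    have := I.comp_right _ g h
    simpa [rel, Preadditive.sub_comp] using this

/-- The quotient category `C / I`; it has the same objects as `C`. -/
abbrev Quot (I : CatIdeal k C) : Type u₂ := CategoryTheory.Quotient I.rel

instance (I : CatIdeal k C) : Preadditive I.Quot :=
  CategoryTheory.Quotient.preadditive I.rel (fun {X Y} f₁ f₂ g₁ g₂ h₁ h₂ => by
    have := (I.carrier _ _).add_mem h₁ h₂
    simpa [rel, add_sub_add_comm] using this)

instance (I : CatIdeal k C) : (CategoryTheory.Quotient.functor I.rel).Additive :=
  CategoryTheory.Quotient.functor_additive I.rel _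

instance (I : CatIdeal k C) : Linear k I.Quot :=
  CategoryTheory.Quotient.linear k I.rel (fun a {X Y} f₁ f₂ h => by
    have := (I.carrier _ _).smul_mem a h
    simpa [rel, smul_sub] using this)

instance (I : CatIdeal k C) : (CategoryTheory.Quotient.functor I.rel).Linear k :=
  CategoryTheory.Quotient.linear_functor k I.rel _

/-- The projection `C → C / I`. -/
abbrev proj (I : CatIdeal k C) : C ⥤ I.Quot := CategoryTheory.Quotient.functor I.rel

/-- A `k`-linear functor that carries `I` into `J` induces a functor `C / I → D / J`. -/
def map {D : Type u₃} [Category.{v₁} D] [Preadditive D] [Linear k D]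
    (I : CatIdeal k C) (J : CatIdeal k D) (F : C ⥤ D) [F.Additive]
    (h : ∀ {X Y : C} (f : X ⟶ Y), f ∈ I.carrier X Y → F.map f ∈ J.carrier _ _) :
    I.Quot ⥤ J.Quot :=
  CategoryTheory.Quotient.lift I.rel (F ⋙ J.proj) (fun X Y f g hfg =>
    CategoryTheory.Quotient.sound _ (by
      have := h _ hfg
      simpa [rel] using this))

section

variable {D : Type u₃} [Category.{v₁} D] [Preadditive D] [Linear k D]
    (I : CatIdeal k C) (J : CatIdeal k D) (F : C ⥤ D) [F.Additive]
    (h : ∀ {X Y : C} (f : X ⟶ Y), f ∈ I.carrier X Y → F.map f ∈ J.carrier _ _)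

theorem map_map {X Y : C} (f : X ⟶ Y) :
    (map I J F h).map (I.proj.map f) = J.proj.map (F.map f) := rfl

instance : (map I J F h).Additive where
  map_add {X Y} f g := by
    obtain ⟨f, rfl⟩ := I.proj.map_surjective f
    obtain ⟨g, rfl⟩ := I.proj.map_surjective g
    rw [← I.proj.map_add, map_map, map_map, map_map, F.map_add, J.proj.map_add]
    rfl

instance [F.Linear k] : (map I J F h).Linear k where
  map_smul {X Y} f r := by
    obtain ⟨f, rfl⟩ := I.proj.map_surjective f
    rw [← I.proj.map_smul, map_map, map_map, F.map_smul, J.proj.map_smul]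
    rfl

end

end CatIdeal

/-! ### Pointwise finite-dimensional representations -/

/-- `k`-linear functors to `k`-vector spaces all of whose values are finite-dimensional. -/
def IsPwf (k : Type u₁) [Field k] (A : Type u₂) [Category.{v₁} A] [Preadditive A] [Linear k A] :
    ObjectProperty (A ⥤ ModuleCat.{w} k) :=
  fun F => F.Additive ∧ F.Linear k ∧ ∀ X, Module.Finite k (F.obj X)

/-- The category of pointwise finite-dimensional representations of `A`, a full subcategory of
the category of functors. -/
abbrev PwfRep (k : Type u₁) [Field k] (A : Type u₂) [Category.{v₁} A] [Preadditive A]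
    [Linear k A] := (IsPwf.{w} k A).FullSubcategory

namespace PwfRep

variable {k : Type u₁} [Field k] {A : Type u₂} [Category.{v₁} A] [Preadditive A] [Linear k A]

/-- Restriction of representations along a `k`-linear functor. -/
def pullback {B : Type u₃} [Category.{v₁} B] [Preadditive B] [Linear k B] (F : A ⥤ B)
    [F.Additive] [F.Linear k] : PwfRep.{w} k B ⥤ PwfRep.{w} k A :=
  ObjectProperty.lift _
    (ObjectProperty.ι _ ⋙ (Functor.whiskeringLeft A B (ModuleCat.{w} k)).obj F) (fun M => by
      obtain ⟨M, hadd, hlin, hfin⟩ := M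
      exact ⟨inferInstanceAs (F ⋙ M).Additive, inferInstanceAs ((F ⋙ M).Linear k),
        fun X => hfin (F.obj X)⟩)

/-- `N` is a direct summand of `M`. -/
def IsDirectSummand (N M : PwfRep.{w} k A) : Prop :=
  ∃ N' : PwfRep.{w} k A, Nonempty (M.obj ≅ N.obj ⊞ N'.obj)

/-- Non-zero, and not a direct sum of two non-zero representations. (Direct summands of a
pointwise finite-dimensional `k`-linear functor are again such functors, so the summands may be
taken in the category of all functors.) -/
def IsIndecomposable (M : PwfRep.{w} k A) : Prop := Indecomposable M.obj

open scoped Classical in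
/-- The morphisms `ι i : V i ⟶ M` exhibit `M` as the (possibly infinite) direct sum of the `V i`:
at every object the canonical map from the direct sum of vector spaces is bijective. -/
def IsDirectSumVia {Λ : Type u₃} (M : PwfRep.{w} k A) (V : Λ → PwfRep.{w} k A)
    (ι : ∀ i, V i ⟶ M) : Prop :=
  ∀ X : A, Function.Bijective
    (DirectSum.toModule k Λ (M.obj.obj X) (fun i => ((ι i).hom.app X).hom))

/-- `M` is isomorphic to the direct sum of the `V i`. -/
def IsDirectSum {Λ : Type u₃} (M : PwfRep.{w} k A) (V : Λ → PwfRep.{w} k A) : Prop :=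
  ∃ ι : ∀ i, V i ⟶ M, IsDirectSumVia M V ι

end PwfRep

/-! ### Thread quivers and their path categories -/

/-- A quiver together with a (possibly empty) linearly ordered set for each arrow. -/
structure ThreadQuiver : Type (u + 1) where
  V : Type u
  [quiver : Quiver.{u} V]
  P : ∀ {a b : V}, (a ⟶ b) → Type u
  [linearOrder : ∀ {a b : V} (α : a ⟶ b), LinearOrder (P α)]

attribute [instance] ThreadQuiver.quiver ThreadQuiver.linearOrder

namespace ThreadQuiver

variable (T : ThreadQuiver.{u})

/-- The objects of the path category: the vertices of the quiver and the points of the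
threads. -/
inductive Obj : Type u
  | vertex (v : T.V) : Obj
  | thread {a b : T.V} (α : a ⟶ b) (x : T.P α) : Obj

variable {T}

/-- The vertex at which a path of the quiver that leads to the object `X` ends: `v` for a
vertex `v`, and the source of `α` for a point of the thread of `α`. -/
def Obj.entry : T.Obj → T.V
  | .vertex v => v
  | .thread (a := a) _ _ => a

/-- The vertex at which a path of the quiver that comes from the object `X` starts: `v` for a
vertex `v`, and the target of `α` for a point of the thread of `α`. -/
def Obj.exit : T.Obj → T.V
  | .vertex v => v
  | .thread (b := b) _ _ => b

/-- The path of the quiver that runs through the object `X`: trivial at a vertex, and `α` at a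
point of the thread of `α`. -/
def Obj.across : (X : T.Obj) → Quiver.Path X.entry X.exit
  | .vertex _ => Quiver.Path.nil
  | .thread α _ => α.toPath

/-- The path-like elements. `through p` is `η_{Y,s(β)} p η_{t(α),X}` for points `X`, `Y` of the
threads of `α`, `β` and a path `p` from `t(α)` to `s(β)`; at a vertex the corresponding factor `η`
is absent, so that `through p` is `p` between vertices. `inside h` is `η_{y,x}` for `x ≤ y` in one
thread. -/
inductive PathLike : T.Obj → T.Obj → Type u
  | through {X Y : T.Obj} (p : Quiver.Path X.exit Y.entry) : PathLike X Y
  | inside {a b : T.V} {α : a ⟶ b} {x y : T.P α} (h : x ≤ y) :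
      PathLike (.thread α x) (.thread α y)

/-- The trivial path-like elements. -/
def PathLike.id : (X : T.Obj) → PathLike X X
  | .vertex _ => .through .nil
  | .thread _ _ => .inside le_rfl

/-- Composition (in diagrammatic order) of path-like elements: concatenation of paths, with
`η_{t(α),y} η_{y,s(α)} = α` and `η_{z,y} η_{y,x} = η_{z,x}`. -/
def PathLike.comp : {X Y Z : T.Obj} → PathLike X Y → PathLike Y Z → PathLike X Z
  | _, Y, _, .through p, .through q => .through (p.comp (Y.across.comp q))
  | _, _, _, .through p, .inside _ => .through p
  | _, _, _, .inside _, .through q => .through q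
  | _, _, _, .inside h, .inside h' => .inside (h.trans h')

/-- The category of path-like elements. -/
instance : Category T.Obj where
  Hom := PathLike
  id := PathLike.id
  comp := PathLike.comp
  id_comp := by
    rintro (v | ⟨α, x⟩) Y (p | h)
    · exact congrArg PathLike.through ((Quiver.Path.nil_comp _).trans (Quiver.Path.nil_comp _))
    · rfl
    · rfl
  comp_id := by
    rintro X (v | ⟨α, x⟩) (p | h)
    · exact congrArg PathLike.through (Quiver.Path.comp_nil _)
    · rfl
    · rfl
  assoc := by
    rintro W X Y Z (p | h) (q | h') (r | h'') <;>
      simp [PathLike.comp, Quiver.Path.comp_assoc] <;> rfl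

/-- The `k`-linear path category: its Hom spaces have the path-like elements as a basis. -/
abbrev PathCat (k : Type u₁) [Field k] (T : ThreadQuiver.{u}) : Type u := Free k T.Obj

/-- The path-like elements `η_{Y,X}` for `X ≤ Y` in one thread, and the trivial paths
`η_{X,X}`. -/
inductive IsEta : ∀ {X Y : T.Obj}, (X ⟶ Y) → Prop
  | refl (X : T.Obj) : IsEta (𝟙 X)
  | inside {a b : T.V} {α : a ⟶ b} {x y : T.P α} (h : x ≤ y) :
      IsEta (PathLike.inside h : Obj.thread α x ⟶ Obj.thread α y)

/-! ### Valid partitions, samples, completion of ideals -/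

/-- A partition of the objects is valid when every vertex is a cell on its own and the points of
every thread form a union of finitely many cells, each of which is an interval. -/
structure IsValid (𝔓 : Setoid T.Obj) : Prop where
  vertex : ∀ (v : T.V) (Y : T.Obj), 𝔓 (.vertex v) Y → Y = .vertex v
  thread : ∀ {a b : T.V} (α : a ⟶ b) (x : T.P α) (Y : T.Obj),
    𝔓 (.thread α x) Y → ∃ y : T.P α, Y = .thread α y
  interval : ∀ {a b : T.V} (α : a ⟶ b) (x : T.P α),
    Set.OrdConnected {y : T.P α | 𝔓 (.thread α x) (.thread α y)}
  finite : ∀ {a b : T.V} (α : a ⟶ b), Finite (Quotient (𝔓.comap (Obj.thread α)))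

/-- A sample of a partition: a set with exactly one point in each cell. -/
def IsSample (𝔓 : Setoid T.Obj) (S : Set T.Obj) : Prop :=
  ∀ X : T.Obj, ∃! Y : T.Obj, Y ∈ S ∧ 𝔓 X Y

section Completion

variable (k : Type u₁) [Field k]

/-- The morphisms `X ⟶ Y` of the path category, for objects `X`, `Y`. -/
abbrev LinHom (X Y : T.Obj) : Type (max u u₁) :=
  (Free.embedding k T.Obj).obj X ⟶ (Free.embedding k T.Obj).obj Y

/-- A path-like element as a morphism of the path category. -/
abbrev lin {X Y : T.Obj} (f : X ⟶ Y) : LinHom k X Y :=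
  (Free.embedding k T.Obj).map f

variable {k}

/-- `𝔓`-equivalence of morphisms `f₁ : X₁ ⟶ Y₁` and `f₂ : X₂ ⟶ Y₂` of the path category: `X₁`, `X₂`
lie in one cell, `Y₁`, `Y₂` lie in one cell, and there are `Z` in the first cell and `W` in the
second cell with `η_{W,Y₁} f₁ η_{X₁,Z} = η_{W,Y₂} f₂ η_{X₂,Z}`. -/
def PEquiv (𝔓 : Setoid T.Obj) {X₁ Y₁ X₂ Y₂ : T.Obj} (f₁ : LinHom k X₁ Y₁) (f₂ : LinHom k X₂ Y₂) :
    Prop :=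
  𝔓 X₁ X₂ ∧ 𝔓 Y₁ Y₂ ∧ ∃ Z W : T.Obj, 𝔓 Z X₁ ∧ 𝔓 W Y₁ ∧
    ∃ (a₁ : Z ⟶ X₁) (a₂ : Z ⟶ X₂) (b₁ : Y₁ ⟶ W) (b₂ : Y₂ ⟶ W),
      IsEta a₁ ∧ IsEta a₂ ∧ IsEta b₁ ∧ IsEta b₂ ∧
        lin k a₁ ≫ f₁ ≫ lin k b₁ = lin k a₂ ≫ f₂ ≫ lin k b₂

/-- The `𝔓`-completion of an ideal: the ideal generated by the morphisms that are `𝔓`-equivalent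
to a morphism of the ideal. -/
def completion (𝔓 : Setoid T.Obj) (I : CatIdeal k (PathCat k T)) : CatIdeal k (PathCat k T) :=
  CatIdeal.generate k fun X Y =>
    {f | ∃ (X' Y' : T.Obj) (g : LinHom k X' Y'), g ∈ I.carrier X' Y' ∧
      PEquiv 𝔓 (X₁ := X) (Y₁ := Y) f g}

theorem le_completion (𝔓 : Setoid T.Obj) (I : CatIdeal k (PathCat k T)) {X Y : PathCat k T}
    (f : X ⟶ Y) (hf : f ∈ I.carrier X Y) : f ∈ (completion 𝔓 I).carrier X Y :=
  CatIdeal.subset_generate _ ⟨X, Y, f, hf, 𝔓.refl _, 𝔓.refl _, X, Y, 𝔓.refl _, 𝔓.refl _,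
    𝟙 _, 𝟙 _, 𝟙 _, 𝟙 _, .refl _, .refl _, .refl _, .refl _, rfl⟩

/-- The projection from `C / I` to the quotient of `C` by the `𝔓`-completion of `I`. -/
def toCompletion (𝔓 : Setoid T.Obj) (I : CatIdeal k (PathCat k T)) :
    I.Quot ⥤ (completion 𝔓 I).Quot :=
  CatIdeal.map I (completion 𝔓 I) (𝟭 _) (fun f hf => le_completion 𝔓 I f hf)

instance (𝔓 : Setoid T.Obj) (I : CatIdeal k (PathCat k T)) : (toCompletion 𝔓 I).Additive :=
  inferInstanceAs (CatIdeal.map _ _ _ _).Additive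

instance (𝔓 : Setoid T.Obj) (I : CatIdeal k (PathCat k T)) : (toCompletion 𝔓 I).Linear k :=
  inferInstanceAs ((CatIdeal.map _ _ _ _).Linear k)

/-- The full subcategory of a quotient of the path category on a set of objects. -/
abbrev sub (I : CatIdeal k (PathCat k T)) (S : Set T.Obj) :=
  ObjectProperty.FullSubcategory (fun X : I.Quot => (X.as : T.Obj) ∈ S)

end Completion

/-! ### The retraction onto a sample -/

section Retraction

variable {𝔓 : Setoid T.Obj} {S : Set T.Obj}

theorem exists_samplePt (h𝔓 : IsValid 𝔓) (hS : IsSample 𝔓 S) {a b : T.V} (α : a ⟶ b) (x : T.P α) :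
    ∃ y : T.P α, Obj.thread α y ∈ S ∧ 𝔓 (.thread α x) (.thread α y) := by
  obtain ⟨Y, ⟨hY, hXY⟩, -⟩ := hS (.thread α x)
  obtain ⟨y, rfl⟩ := h𝔓.thread α x Y hXY
  exact ⟨y, hY, hXY⟩

/-- The sample point in the cell of a point of a thread. -/
def samplePt (h𝔓 : IsValid 𝔓) (hS : IsSample 𝔓 S) {a b : T.V} (α : a ⟶ b) (x : T.P α) : T.P α :=
  (exists_samplePt h𝔓 hS α x).choose

theorem samplePt_mem (h𝔓 : IsValid 𝔓) (hS : IsSample 𝔓 S) {a b : T.V} (α : a ⟶ b) (x : T.P α) :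
    Obj.thread α (samplePt h𝔓 hS α x) ∈ S :=
  (exists_samplePt h𝔓 hS α x).choose_spec.1

theorem samplePt_rel (h𝔓 : IsValid 𝔓) (hS : IsSample 𝔓 S) {a b : T.V} (α : a ⟶ b) (x : T.P α) :
    𝔓 (.thread α x) (.thread α (samplePt h𝔓 hS α x)) :=
  (exists_samplePt h𝔓 hS α x).choose_spec.2

theorem samplePt_eq (h𝔓 : IsValid 𝔓) (hS : IsSample 𝔓 S) {a b : T.V} (α : a ⟶ b) {x y : T.P α}
    (h : 𝔓 (.thread α x) (.thread α y)) : samplePt h𝔓 hS α x = samplePt h𝔓 hS α y := by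
  have := (hS (.thread α x)).unique ⟨samplePt_mem h𝔓 hS α x, samplePt_rel h𝔓 hS α x⟩
    ⟨samplePt_mem h𝔓 hS α y, 𝔓.trans h (samplePt_rel h𝔓 hS α y)⟩
  simpa using this

theorem samplePt_mono (h𝔓 : IsValid 𝔓) (hS : IsSample 𝔓 S) {a b : T.V} (α : a ⟶ b) {x y : T.P α}
    (h : x ≤ y) : samplePt h𝔓 hS α x ≤ samplePt h𝔓 hS α y := by
  by_contra! hlt
  have hx := samplePt_rel h𝔓 hS α x
  have hy := samplePt_rel h𝔓 hS α y
  have key : 𝔓 (.thread α x) (.thread α y) := by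
    rcases le_total (samplePt h𝔓 hS α y) x with h' | h'
    · exact 𝔓.symm ((h𝔓.interval α y).out hy (𝔓.refl _) ⟨h', h⟩)
    · exact 𝔓.trans ((h𝔓.interval α x).out (𝔓.refl _) hx ⟨h', hlt.le⟩) (𝔓.symm hy)
  exact hlt.ne' (samplePt_eq h𝔓 hS α key)

/-- The sample point `s_X` in the cell of an object `X`. -/
def sampleObj (h𝔓 : IsValid 𝔓) (hS : IsSample 𝔓 S) : T.Obj → T.Obj
  | .vertex v => .vertex v
  | .thread α x => .thread α (samplePt h𝔓 hS α x)

theorem sampleObj_rel (h𝔓 : IsValid 𝔓) (hS : IsSample 𝔓 S) (X : T.Obj) :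
    𝔓 X (sampleObj h𝔓 hS X) := by
  rcases X with v | ⟨α, x⟩
  · exact 𝔓.refl _
  · exact samplePt_rel h𝔓 hS α x

theorem sampleObj_mem (h𝔓 : IsValid 𝔓) (hS : IsSample 𝔓 S) (X : T.Obj) :
    sampleObj h𝔓 hS X ∈ S := by
  rcases X with v | ⟨α, x⟩
  · obtain ⟨Y, ⟨hY, hXY⟩, -⟩ := hS (.vertex v)
    obtain rfl := h𝔓.vertex v Y hXY
    exact hY
  · exact samplePt_mem h𝔓 hS α x

theorem sampleObj_entry (h𝔓 : IsValid 𝔓) (hS : IsSample 𝔓 S) (X : T.Obj) :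
    (sampleObj h𝔓 hS X).entry = X.entry := by
  cases X <;> rfl

theorem sampleObj_exit (h𝔓 : IsValid 𝔓) (hS : IsSample 𝔓 S) (X : T.Obj) :
    (sampleObj h𝔓 hS X).exit = X.exit := by
  cases X <;> rfl

/-- The path-like element from `s_X` to `s_Y` that runs along the same path as a given one from
`X` to `Y`. -/
def sampleMap (h𝔓 : IsValid 𝔓) (hS : IsSample 𝔓 S) : {X Y : T.Obj} → PathLike X Y →
    PathLike (sampleObj h𝔓 hS X) (sampleObj h𝔓 hS Y)
  | X, Y, .through p =>
      .through (p.cast (sampleObj_exit h𝔓 hS X).symm (sampleObj_entry h𝔓 hS Y).symm)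
  | _, _, .inside h => .inside (samplePt_mono h𝔓 hS _ h)

/-- The retraction on path-like elements. -/
def retractBasis (h𝔓 : IsValid 𝔓) (hS : IsSample 𝔓 S) : T.Obj ⥤ T.Obj where
  obj := sampleObj h𝔓 hS
  map f := sampleMap h𝔓 hS f
  map_id X := by
    rcases X with v | ⟨α, x⟩ <;> rfl
  map_comp {X Y Z} f g := by
    rcases f with p | h <;> rcases g with q | h'
    · rcases X with v | ⟨α, x⟩ <;> rcases Y with v | ⟨α, x⟩ <;> rcases Z with v | ⟨α, x⟩ <;> rfl
    · rcases X with v | ⟨α, x⟩ <;> rfl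
    · rcases Z with v | ⟨α, x⟩ <;> rfl
    · rfl

theorem retractBasis_spec (h𝔓 : IsValid 𝔓) (hS : IsSample 𝔓 S) (X Y : T.Obj) :
    ∃ Z W : T.Obj, 𝔓 Z ((retractBasis h𝔓 hS).obj X) ∧ 𝔓 W ((retractBasis h𝔓 hS).obj Y) ∧
      ∃ (a₁ : Z ⟶ (retractBasis h𝔓 hS).obj X) (a₂ : Z ⟶ X)
        (b₁ : (retractBasis h𝔓 hS).obj Y ⟶ W) (b₂ : Y ⟶ W),
        IsEta a₁ ∧ IsEta a₂ ∧ IsEta b₁ ∧ IsEta b₂ ∧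
          ∀ f : X ⟶ Y, a₁ ≫ (retractBasis h𝔓 hS).map f ≫ b₁ = a₂ ≫ f ≫ b₂ := by
  have cell : ∀ {a b : T.V} (α : a ⟶ b) (x : T.P α),
      𝔓 (.thread α (min (samplePt h𝔓 hS α x) x)) (.thread α (samplePt h𝔓 hS α x)) ∧
      𝔓 (.thread α (max (samplePt h𝔓 hS α x) x)) (.thread α (samplePt h𝔓 hS α x)) := by
    intro a b α x
    have := samplePt_rel h𝔓 hS α x
    rcases le_total (samplePt h𝔓 hS α x) x with h | h
    · rw [min_eq_left h, max_eq_right h]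
      exact ⟨𝔓.refl _, this⟩
    · rw [min_eq_right h, max_eq_left h]
      exact ⟨this, 𝔓.refl _⟩
  rcases X with v | ⟨α, x⟩ <;> rcases Y with w | ⟨β, y⟩
  · exact ⟨.vertex v, .vertex w, 𝔓.refl _, 𝔓.refl _, 𝟙 _, 𝟙 _, 𝟙 _, 𝟙 _,
      .refl _, .refl _, .refl _, .refl _, by rintro (p | h); rfl⟩
  · exact ⟨.vertex v, .thread β (max (samplePt h𝔓 hS β y) y), 𝔓.refl _, (cell β y).2,
      𝟙 _, 𝟙 _, .inside (le_max_left _ _), .inside (le_max_right _ _),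
      .refl _, .refl _, .inside _, .inside _, by rintro (p | h); rfl⟩
  · exact ⟨.thread α (min (samplePt h𝔓 hS α x) x), .vertex w, (cell α x).1, 𝔓.refl _,
      .inside (min_le_left _ _), .inside (min_le_right _ _), 𝟙 _, 𝟙 _,
      .inside _, .inside _, .refl _, .refl _, by rintro (p | h); rfl⟩
  · exact ⟨.thread α (min (samplePt h𝔓 hS α x) x), .thread β (max (samplePt h𝔓 hS β y) y),
      (cell α x).1, (cell β y).2, .inside (min_le_left _ _), .inside (min_le_right _ _),
      .inside (le_max_left _ _), .inside (le_max_right _ _),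
      .inside _, .inside _, .inside _, .inside _, by rintro (p | h) <;> rfl⟩

variable (k : Type u₁) [Field k]

theorem linHom_induction {X Y : T.Obj} {p : LinHom k X Y → Prop} (f : LinHom k X Y)
    (zero : p 0) (add : ∀ f g, p f → p g → p (f + g)) (smul : ∀ (r : k) (g : X ⟶ Y), p (r • lin k g)) :
    p f := by
  refine Finsupp.induction_linear (motive := p) f zero add (fun g r => ?_)
  exact Finsupp.smul_single_one g r ▸ smul r g

/-- The retraction on morphisms of the path category, extended linearly from path-like
elements. -/
def retractHom (h𝔓 : IsValid 𝔓) (hS : IsSample 𝔓 S) (X Y : T.Obj) :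
    LinHom k X Y →ₗ[k]
      LinHom k ((retractBasis h𝔓 hS).obj X) ((retractBasis h𝔓 hS).obj Y) :=
  Finsupp.lmapDomain k k (fun g : X ⟶ Y => (retractBasis h𝔓 hS).map g)

theorem retractHom_lin (h𝔓 : IsValid 𝔓) (hS : IsSample 𝔓 S) {X Y : T.Obj} (g : X ⟶ Y) :
    retractHom k h𝔓 hS X Y (lin k g) = lin k ((retractBasis h𝔓 hS).map g) :=
  Finsupp.mapDomain_single

theorem retractHom_comp (h𝔓 : IsValid 𝔓) (hS : IsSample 𝔓 S) {X Y Z : T.Obj}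
    (f : LinHom k X Y) (g : LinHom k Y Z) :
    retractHom k h𝔓 hS X Z (f ≫ g) = retractHom k h𝔓 hS X Y f ≫ retractHom k h𝔓 hS Y Z g := by
  induction f using linHom_induction with
  | zero => rw [zero_comp, map_zero, map_zero, zero_comp]
  | add f₁ f₂ h₁ h₂ => rw [Preadditive.add_comp, map_add, map_add, Preadditive.add_comp, h₁, h₂]
  | smul r f =>
    induction g using linHom_induction with
    | zero => rw [comp_zero, map_zero, map_zero, comp_zero]
    | add g₁ g₂ h₁ h₂ => rw [Preadditive.comp_add, map_add, map_add, Preadditive.comp_add, h₁, h₂]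
    | smul s g =>
      rw [Linear.smul_comp, Linear.comp_smul, map_smul, map_smul, map_smul, map_smul,
        Linear.smul_comp, Linear.comp_smul, ← Functor.map_comp, retractHom_lin, retractHom_lin,
        retractHom_lin, Functor.map_comp, ← Functor.map_comp (Free.embedding k T.Obj)]

/-- The retraction on the path category. -/
def retractPath (h𝔓 : IsValid 𝔓) (hS : IsSample 𝔓 S) : PathCat k T ⥤ PathCat k T where
  obj X := (Free.embedding k T.Obj).obj ((retractBasis h𝔓 hS).obj X)
  map {X Y} f := retractHom k h𝔓 hS X Y f
  map_id X := (retractHom_lin k h𝔓 hS (CategoryStruct.id (obj := T.Obj) X)).trans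
    (congrArg (lin k) ((retractBasis h𝔓 hS).map_id X))
  map_comp f g := retractHom_comp k h𝔓 hS f g

instance (h𝔓 : IsValid 𝔓) (hS : IsSample 𝔓 S) : (retractPath k h𝔓 hS).Additive where
  map_add {X Y} f g := (retractHom k h𝔓 hS X Y).map_add f g

instance (h𝔓 : IsValid 𝔓) (hS : IsSample 𝔓 S) : (retractPath k h𝔓 hS).Linear k where
  map_smul {X Y} f r := (retractHom k h𝔓 hS X Y).map_smul r f

variable {k}

/-- The retraction sends a morphism `X ⟶ Y` to a `𝔓`-equivalent morphism `s_X ⟶ s_Y`. -/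
theorem retractHom_pEquiv (h𝔓 : IsValid 𝔓) (hS : IsSample 𝔓 S) {X Y : T.Obj} (f : LinHom k X Y) :
    PEquiv 𝔓 (retractHom k h𝔓 hS X Y f) f := by
  obtain ⟨Z, W, hZ, hW, a₁, a₂, b₁, b₂, ha₁, ha₂, hb₁, hb₂, H⟩ := retractBasis_spec h𝔓 hS X Y
  refine ⟨𝔓.symm (sampleObj_rel h𝔓 hS X), 𝔓.symm (sampleObj_rel h𝔓 hS Y), Z, W, hZ, hW,
    a₁, a₂, b₁, b₂, ha₁, ha₂, hb₁, hb₂, ?_⟩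
  induction f using linHom_induction with
  | zero => rw [map_zero, zero_comp, comp_zero, zero_comp, comp_zero]
  | add f₁ f₂ h₁ h₂ =>
    rw [map_add, Preadditive.add_comp, Preadditive.comp_add, h₁, h₂, Preadditive.add_comp,
      Preadditive.comp_add]
  | smul r f =>
    rw [map_smul, retractHom_lin, Linear.smul_comp, Linear.comp_smul, Linear.smul_comp,
      Linear.comp_smul, ← Functor.map_comp, ← Functor.map_comp, ← Functor.map_comp,
      ← Functor.map_comp, H]

theorem isIso_retractHom (h𝔓 : IsValid 𝔓) (hS : IsSample 𝔓 S) {X Y : T.Obj} {a : X ⟶ Y}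
    (ha : IsEta a) (hXY : 𝔓 X Y) : IsIso (retractHom k h𝔓 hS X Y (lin k a)) := by
  rw [retractHom_lin]
  suffices IsIso ((retractBasis h𝔓 hS).map a) from
    inferInstanceAs (IsIso ((Free.embedding k T.Obj).map ((retractBasis h𝔓 hS).map a)))
  cases ha with
  | refl => infer_instance
  | @inside _ _ α x y h =>
    have e := samplePt_eq h𝔓 hS α hXY
    exact ⟨PathLike.inside e.symm.le, rfl, rfl⟩

theorem retractHom_mem_of_eq (h𝔓 : IsValid 𝔓) (hS : IsSample 𝔓 S) (J : CatIdeal k (PathCat k T))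
    {X Y X' Y' Z W : T.Obj} {f : LinHom k X Y} {g : LinHom k X' Y'}
    {a₁ : LinHom k Z X} {a₂ : LinHom k Z X'} {b₁ : LinHom k Y W} {b₂ : LinHom k Y' W}
    (hg : retractHom k h𝔓 hS X' Y' g ∈ J.carrier _ _)
    (i₁ : IsIso (retractHom k h𝔓 hS Z X a₁)) (i₂ : IsIso (retractHom k h𝔓 hS Y W b₁))
    (H : a₁ ≫ f ≫ b₁ = a₂ ≫ g ≫ b₂) : retractHom k h𝔓 hS X Y f ∈ J.carrier _ _ := by
  have H' := congrArg (retractHom k h𝔓 hS Z W) H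
  rw [retractHom_comp, retractHom_comp, retractHom_comp, retractHom_comp] at H'
  have H'' : retractHom k h𝔓 hS X Y f = inv (retractHom k h𝔓 hS Z X a₁) ≫
      (retractHom k h𝔓 hS Z X' a₂ ≫ retractHom k h𝔓 hS X' Y' g ≫ retractHom k h𝔓 hS Y' W b₂) ≫
        inv (retractHom k h𝔓 hS Y W b₁) := by
    rw [← H']
    simp
  rw [H'']
  exact J.comp_left _ _ (J.comp_right _ _ (J.comp_left _ _ (J.comp_right _ _ hg)))

/-- The retraction preserves the `𝔓`-completion of an ideal. -/
theorem retractPath_mem (h𝔓 : IsValid 𝔓) (hS : IsSample 𝔓 S) (I : CatIdeal k (PathCat k T))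
    {X Y : PathCat k T} (f : X ⟶ Y) (hf : f ∈ (completion 𝔓 I).carrier X Y) :
    (retractPath k h𝔓 hS).map f ∈ (completion 𝔓 I).carrier _ _ := by
  let J : CatIdeal k (PathCat k T) :=
    { carrier := fun X Y => ((completion 𝔓 I).carrier _ _).comap (retractHom k h𝔓 hS X Y)
      comp_left := fun {X Y Z} f g hg => by
        have := (completion 𝔓 I).comp_left (retractHom k h𝔓 hS X Y f) _ hg
        exact (congrArg (· ∈ (completion 𝔓 I).carrier _ _)
          (retractHom_comp k h𝔓 hS f g)).mpr this
      comp_right := fun {X Y Z} f g hf => by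
        have := (completion 𝔓 I).comp_right _ (retractHom k h𝔓 hS Y Z g) hf
        exact (congrArg (· ∈ (completion 𝔓 I).carrier _ _)
          (retractHom_comp k h𝔓 hS f g)).mpr this }
  refine CatIdeal.mem_of_mem_generate hf J ?_
  rintro X Y f ⟨X', Y', g, hg, hX, hY, Z, W, hZ, hW, a₁, a₂, b₁, b₂, ha₁, ha₂, hb₁, hb₂, H⟩
  have hg' : retractHom k h𝔓 hS X' Y' g ∈ (completion 𝔓 I).carrier _ _ :=
    CatIdeal.subset_generate _ ⟨X', Y', g, hg, retractHom_pEquiv h𝔓 hS g⟩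
  exact retractHom_mem_of_eq h𝔓 hS (completion 𝔓 I) hg' (isIso_retractHom h𝔓 hS ha₁ hZ)
    (isIso_retractHom h𝔓 hS hb₁ (𝔓.symm hW)) H

/-- The retraction `𝐫` of the quotient by the `𝔓`-completion of `I` onto its full subcategory on
the sample `S`: it sends `X` to the sample point `s_X` of its cell and the class of a morphism
`f : X ⟶ Y` to the class of the `𝔓`-equivalent morphism `s_X ⟶ s_Y`. -/
def retraction (h𝔓 : IsValid 𝔓) (hS : IsSample 𝔓 S) (I : CatIdeal k (PathCat k T)) :
    (completion 𝔓 I).Quot ⥤ sub (completion 𝔓 I) S :=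
  ObjectProperty.lift _
    (CatIdeal.map (completion 𝔓 I) (completion 𝔓 I) (retractPath k h𝔓 hS)
      (retractPath_mem h𝔓 hS I))
    (fun X => sampleObj_mem h𝔓 hS X.as)

instance (h𝔓 : IsValid 𝔓) (hS : IsSample 𝔓 S) (I : CatIdeal k (PathCat k T)) :
    (retraction h𝔓 hS I).Additive where
  map_add {_ _ f g} := ObjectProperty.hom_ext _ (Functor.map_add
    (CatIdeal.map (completion 𝔓 I) (completion 𝔓 I) (retractPath k h𝔓 hS)
      (retractPath_mem h𝔓 hS I)) (f := f) (g := g))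

instance (h𝔓 : IsValid 𝔓) (hS : IsSample 𝔓 S) (I : CatIdeal k (PathCat k T)) :
    (retraction h𝔓 hS I).Linear k where
  map_smul f r := ObjectProperty.hom_ext _ (Functor.map_smul
    (CatIdeal.map (completion 𝔓 I) (completion 𝔓 I) (retractPath k h𝔓 hS)
      (retractPath_mem h𝔓 hS I)) r f)

/-- The induction functor `Ind_𝔓 = 𝐫^*`, from representations of the full subcategory on the sample
to representations of the quotient by the `𝔓`-completion of `I`. -/
def ind (h𝔓 : IsValid 𝔓) (hS : IsSample 𝔓 S) (I : CatIdeal k (PathCat k T)) :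
    PwfRep.{w} k (sub (completion 𝔓 I) S) ⥤ PwfRep.{w} k (completion 𝔓 I).Quot :=
  PwfRep.pullback (retraction h𝔓 hS I)

/-- The inclusion of the representations of the quotient by the `𝔓`-completion of `I` into the
representations of the quotient by `I`. -/
def inflate (𝔓 : Setoid T.Obj) (I : CatIdeal k (PathCat k T)) :
    PwfRep.{w} k (completion 𝔓 I).Quot ⥤ PwfRep.{w} k I.Quot :=
  PwfRep.pullback (toCompletion 𝔓 I)

end Retraction

/-! ### Noise, and the partition induced by a representation -/

section Noise

variable {k : Type u₁} [Field k] {I : CatIdeal k (PathCat k T)}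

/-- The value of a representation of `C / I` at an object. -/
abbrev val (M : PwfRep.{w} k I.Quot) (X : T.Obj) : ModuleCat.{w} k :=
  M.obj.obj (I.proj.obj ((Free.embedding k T.Obj).obj X))

/-- The linear map by which a path-like element acts on a representation of `C / I`. -/
abbrev act (M : PwfRep.{w} k I.Quot) {X Y : T.Obj} (f : X ⟶ Y) : val M X ⟶ val M Y :=
  M.obj.map (I.proj.map (lin k f))

/-- The action of `η_{y,x}`, for `x ≤ y` in the thread of `α`. -/
abbrev actEta (M : PwfRep.{w} k I.Quot) {a b : T.V} {α : a ⟶ b} {x y : T.P α} (h : x ≤ y) :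
    val M (.thread α x) ⟶ val M (.thread α y) :=
  act M (PathLike.inside h : Obj.thread α x ⟶ Obj.thread α y)

/-- A representation is noise if its support contains no vertex of the quiver. -/
def IsNoise (M : PwfRep.{w} k I.Quot) : Prop := ∀ v : T.V, IsZero (val M (.vertex v))

/-- A representation is noise free if it has no non-zero direct summand that is noise. -/
def IsNoiseFree (M : PwfRep.{w} k I.Quot) : Prop :=
  ∀ N : PwfRep.{w} k I.Quot, N.IsDirectSummand M → IsNoise N → IsZero N.obj

/-- `x ≤ y`, and `η_{z,x}` and `η_{y,z}` act by isomorphisms whenever `x ≤ z ≤ y`. -/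
def ConstBetween (M : PwfRep.{w} k I.Quot) {a b : T.V} {α : a ⟶ b} (x y : T.P α) : Prop :=
  x ≤ y ∧ ∀ (z : T.P α) (h₁ : x ≤ z) (h₂ : z ≤ y), IsIso (actEta M h₁) ∧ IsIso (actEta M h₂)

/-- Two objects lie in the same cell of the partition induced by `M`. -/
inductive SameCell (M : PwfRep.{w} k I.Quot) : T.Obj → T.Obj → Prop
  | vertex (v : T.V) : SameCell M (.vertex v) (.vertex v)
  | le {a b : T.V} (α : a ⟶ b) (x y : T.P α) (h : ConstBetween M x y) :
      SameCell M (.thread α x) (.thread α y)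
  | ge {a b : T.V} (α : a ⟶ b) (x y : T.P α) (h : ConstBetween M y x) :
      SameCell M (.thread α x) (.thread α y)

theorem act_comp (M : PwfRep.{w} k I.Quot) {X Y Z : T.Obj} (f : X ⟶ Y) (g : Y ⟶ Z) :
    act M (f ≫ g) = act M f ≫ act M g := by
  rw [act, lin, Functor.map_comp, Functor.map_comp, Functor.map_comp]

theorem actEta_comp (M : PwfRep.{w} k I.Quot) {a b : T.V} {α : a ⟶ b} {x y z : T.P α}
    (h : x ≤ y) (h' : y ≤ z) : actEta M (h.trans h') = actEta M h ≫ actEta M h' :=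
  act_comp M (X := .thread α x) (Y := .thread α y) (Z := .thread α z)
    (PathLike.inside h) (PathLike.inside h')

theorem constBetween_iff (M : PwfRep.{w} k I.Quot) {a b : T.V} {α : a ⟶ b} (x y : T.P α) :
    ConstBetween M x y ↔ x ≤ y ∧ ∀ (z t : T.P α) (_ : x ≤ z) (h : z ≤ t) (_ : t ≤ y),
      IsIso (actEta M h) := by
  constructor
  · rintro ⟨hxy, H⟩
    refine ⟨hxy, fun z t hxz hzt hty => ?_⟩
    have h₁ := (H z hxz (hzt.trans hty)).1
    have h₂ := (H t (hxz.trans hzt) hty).1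
    have h₃ := actEta_comp M hxz hzt
    rw [h₃] at h₂
    exact IsIso.of_isIso_comp_left (actEta M hxz) (actEta M hzt)
  · rintro ⟨hxy, H⟩
    exact ⟨hxy, fun z h₁ h₂ => ⟨H _ _ le_rfl h₁ h₂, H _ _ h₁ h₂ le_rfl⟩⟩

theorem constBetween_refl (M : PwfRep.{w} k I.Quot) {a b : T.V} {α : a ⟶ b} (x : T.P α) :
    ConstBetween M x x := by
  refine (constBetween_iff M x x).2 ⟨le_rfl, fun z t h₁ h h₂ => ?_⟩
  obtain rfl : z = x := le_antisymm (h.trans h₂) h₁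
  obtain rfl : t = z := le_antisymm h₂ h
  exact inferInstanceAs (IsIso (act M (𝟙 (Obj.thread α t))))

theorem constBetween_mono (M : PwfRep.{w} k I.Quot) {a b : T.V} {α : a ⟶ b} {x y z t : T.P α}
    (h : ConstBetween M x t) (h₁ : x ≤ y) (h₂ : y ≤ z) (h₃ : z ≤ t) : ConstBetween M y z := by
  rw [constBetween_iff] at h ⊢
  exact ⟨h₂, fun _ _ h₄ h₅ h₆ => h.2 _ _ (h₁.trans h₄) h₅ (h₆.trans h₃)⟩

theorem constBetween_trans (M : PwfRep.{w} k I.Quot) {a b : T.V} {α : a ⟶ b} {x y z : T.P α}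
    (h : ConstBetween M x y) (h' : ConstBetween M y z) : ConstBetween M x z := by
  rw [constBetween_iff] at h h' ⊢
  refine ⟨h.1.trans h'.1, fun s t h₁ h₂ h₃ => ?_⟩
  rcases le_total t y with ht | ht
  · exact h.2 _ _ h₁ h₂ ht
  · rcases le_total s y with hs | hs
    · have i₁ := h.2 _ _ h₁ hs le_rfl
      have i₂ := h'.2 _ _ le_rfl ht h₃
      rw [actEta_comp M hs ht]
      infer_instance
    · exact h'.2 _ _ hs h₂ h₃

/-- The partition `𝔓_M` of the objects induced by a representation `M`: every vertex is a cell,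
and `x ≤ y` in one thread lie in one cell if and only if `η_{z,x}` and `η_{y,z}` act by
isomorphisms for all `x ≤ z ≤ y`. -/
def partition (M : PwfRep.{w} k I.Quot) : Setoid T.Obj where
  r := SameCell M
  iseqv :=
    { refl := by
        rintro (v | ⟨α, x⟩)
        · exact .vertex v
        · exact .le α x x (constBetween_refl M x)
      symm := by
        rintro _ _ (v | ⟨α, x, y, h⟩ | ⟨α, x, y, h⟩)
        · exact .vertex v
        · exact .ge α y x h
        · exact .le α y x h
      trans := by
        rintro _ _ _ (v | ⟨α, x, y, h⟩ | ⟨α, x, y, h⟩) h'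
        · exact h'
        · rcases h' with _ | ⟨_, _, z, h'⟩ | ⟨_, _, z, h'⟩
          · exact .le α x z (constBetween_trans M h h')
          · rcases le_total x z with hxz | hzx
            · exact .le α x z (constBetween_mono M h le_rfl hxz h'.1)
            · exact .ge α x z (constBetween_mono M h' le_rfl hzx h.1)
        · rcases h' with _ | ⟨_, _, z, h'⟩ | ⟨_, _, z, h'⟩
          · rcases le_total x z with hxz | hzx
            · exact .le α x z (constBetween_mono M h' h.1 hxz le_rfl)
            · exact .ge α x z (constBetween_mono M h h'.1 hzx le_rfl)
          · exact .ge α x z (constBetween_trans M h' h) }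

end Noise

end ThreadQuiver

end

-- Two independent facts combine: noise freeness makes the partition of `Z` valid and `Z` constant
-- on its cells, and pointwise finite-dimensional representations satisfy a Krull–Schmidt–Azumaya
-- theorem.
--
-- Validity. On the thread of α : a → b, the representation is a system of finite-dimensional spaces
-- V x with maps from Z a and to Z b. If some vector of V x₀ dies in Z b but does not come from Z a,
-- then an interval module through x₀ splits off the thread, killed by both maps
-- (`exists_idempotent_of_not_ker_le_range`). Extended by zero it is a noise summand of `Z`. So for
-- noise free `Z` the kernel of V x → Z b lies in the image of Z a → V x
-- (`ker_toTarget_le_range_fromSource`). Under this condition V x → V y is bijective once the rank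
-- of the map to Z b and the nullity of the map from Z a agree at x and y
-- (`bijective_of_finrank_eq`). Both numbers are monotone and bounded along the thread, so there are
-- finitely many cells.
--
-- Decomposition. A maximal set of commuting idempotent endomorphisms is diagonalized simultaneously
-- at every object; maximality makes the joint eigenrepresentations indecomposable
-- (`exists_isDirectSum_indecomposable`). Endomorphism rings of indecomposables are local by
-- Fitting's lemma (`isLocalRing_end`), and comparing matrices over such a ring shows that two
-- decompositions have equal multiplicities (`exists_equiv_of_isDirectSum`).
--
-- Induction. A summand of `Z` inherits invertibility of the η within cells. It therefore vanishes
-- on the completed ideal and is isomorphic to the representation induced from its restriction to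
-- the sample (`nonempty_inflate_ind_sampleRep_iso`). Since the retraction is surjective on objects,
-- the restriction is indecomposable too.

universe u₄

noncomputable section

/-! ### Idempotents and indecomposable objects -/

section Idempotents

variable {C : Type u₂} [Category.{v₁} C] [Preadditive C] [HasBinaryBiproducts C]

/-- An idempotent and its complement split off complementary direct summands. -/
theorem exists_iso_biprod_of_idempotent [IsIdempotentComplete C] {X : C} (e : X ⟶ X)
    (he : e ≫ e = e) :
    ∃ (Y Y' : C) (i : Y ⟶ X) (p : X ⟶ Y) (i' : Y' ⟶ X) (p' : X ⟶ Y'),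
      i ≫ p = 𝟙 Y ∧ p ≫ i = e ∧ i' ≫ p' = 𝟙 Y' ∧ p' ≫ i' = 𝟙 X - e ∧
        Nonempty (X ≅ Y ⊞ Y') := by
  obtain ⟨Y, i, p, hip, hpi⟩ := IsIdempotentComplete.idempotents_split X e he
  obtain ⟨Y', i', p', hip', hpi'⟩ := IsIdempotentComplete.idempotents_split X (𝟙 X - e)
    (by simp [Preadditive.sub_comp, Preadditive.comp_sub, he])
  have h₁ : i ≫ p' = 0 := by
    have : i ≫ p' = (i ≫ p ≫ i) ≫ (p' ≫ i' ≫ p') := by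
      rw [hip', reassoc_of% hip, Category.comp_id]
    rw [this, hpi, reassoc_of% hpi']
    simp [Preadditive.sub_comp, Preadditive.comp_sub, reassoc_of% he]
  have h₂ : i' ≫ p = 0 := by
    have : i' ≫ p = (i' ≫ p' ≫ i') ≫ (p ≫ i ≫ p) := by
      rw [hip, reassoc_of% hip', Category.comp_id]
    rw [this, hpi', reassoc_of% hpi]
    simp [Preadditive.sub_comp, Preadditive.comp_sub, reassoc_of% he]
  refine ⟨Y, Y', i, p, i', p', hip, hpi, hip', hpi', ⟨⟨biprod.lift p p', biprod.desc i i', ?_, ?_⟩⟩⟩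
  · rw [biprod.lift_desc, hpi, hpi', add_sub_cancel]
  · ext <;> simp [hip, hip', h₁, h₂]

/-- Indecomposability is used below only in this form. A splitting X ≅ Y ⊞ Z corresponds to the
projection onto Y, which is 0 only if Y = 0 and 1 only if Z = 0. -/
theorem indecomposable_iff_idempotent [IsIdempotentComplete C] (X : C) :
    Indecomposable X ↔
      ¬ IsZero X ∧ ∀ e : X ⟶ X, e ≫ e = e → e = 0 ∨ e = 𝟙 X := by
  refine and_congr_right fun _ => ⟨fun H e he => ?_, fun H Y Z i => ?_⟩
  · obtain ⟨Y, Y', i, p, i', p', hip, hpi, hip', hpi', ⟨f⟩⟩ := exists_iso_biprod_of_idempotent e he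
    rcases H Y Y' f with h | h
    · left
      rw [← hpi, h.eq_of_tgt p 0, zero_comp]
    · right
      rw [h.eq_of_tgt p' 0, zero_comp] at hpi'
      exact (sub_eq_zero.1 hpi'.symm).symm
  · rcases H (i.hom ≫ biprod.fst ≫ biprod.inl ≫ i.inv) (by simp) with h | h
    · left
      rw [IsZero.iff_id_eq_zero]
      have : biprod.inl ≫ i.inv ≫ (i.hom ≫ biprod.fst ≫ biprod.inl ≫ i.inv) ≫ i.hom ≫ biprod.fst
        = 𝟙 Y := by simp
      rw [← this, h]
      simp
    · right
      rw [IsZero.iff_id_eq_zero]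
      have : biprod.inr ≫ i.inv ≫ (i.hom ≫ biprod.fst ≫ biprod.inl ≫ i.inv) ≫ i.hom ≫ biprod.snd
        = (0 : Z ⟶ Z) := by simp
      rw [← this, h]
      simp

end Idempotents

/-! ### Functors to vector spaces -/

section Functors

variable {k : Type u₁} [Field k] {A : Type u₂} [Category.{v₁} A]

theorem isZero_functor_iff (M : A ⥤ ModuleCat.{w} k) :
    IsZero M ↔ ∀ X, Subsingleton (M.obj X) := by
  rw [Functor.isZero_iff]
  exact forall_congr' fun X => ModuleCat.isZero_iff_subsingleton

theorem comp_app_apply {L M N : A ⥤ ModuleCat.{w} k} (f : L ⟶ M) (g : M ⟶ N) (X : A)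
    (x : L.obj X) : ((f ≫ g).app X).hom x = (g.app X).hom ((f.app X).hom x) := rfl

theorem naturality_hom_apply {M N : A ⥤ ModuleCat.{w} k} (f : M ⟶ N) {X Y : A} (a : X ⟶ Y)
    (x : M.obj X) :
    (f.app Y).hom ((M.map a).hom x) = (N.map a).hom ((f.app X).hom x) :=
  congrArg (fun h => h.hom x) (f.naturality a)

theorem natTrans_ext_hom {M N : A ⥤ ModuleCat.{w} k} {f g : M ⟶ N}
    (h : ∀ X x, (f.app X).hom x = (g.app X).hom x) : f = g := by
  ext X x
  exact h X x

theorem isIso_of_bijective_app {M N : A ⥤ ModuleCat.{w} k} (f : M ⟶ N)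
    (h : ∀ X, Function.Bijective (f.app X).hom) : IsIso f := by
  have : ∀ X, IsIso (f.app X) := fun X =>
    (ConcreteCategory.isIso_iff_bijective (f.app X)).2 (h X)
  exact NatIso.isIso_of_isIso_app f

theorem bijective_app_of_isIso {M N : A ⥤ ModuleCat.{w} k} (f : M ⟶ N) [IsIso f] (X : A) :
    Function.Bijective (f.app X).hom :=
  (ConcreteCategory.isIso_iff_bijective (f.app X)).1 inferInstance

theorem injective_app_of_comp_eq_id {M N : A ⥤ ModuleCat.{w} k} {i : N ⟶ M} {p : M ⟶ N}
    (h : i ≫ p = 𝟙 N) (X : A) : Function.Injective (i.app X).hom :=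
  Function.LeftInverse.injective (g := (p.app X).hom) fun x => by
    rw [← comp_app_apply, h]
    rfl

/-- The subfunctor of `M` given by a family of subspaces that is stable under the action. -/
def subfunctorOf (M : A ⥤ ModuleCat.{w} k) (N : ∀ X, Submodule k (M.obj X))
    (h : ∀ {X Y : A} (f : X ⟶ Y), ∀ x ∈ N X, (M.map f).hom x ∈ N Y) : A ⥤ ModuleCat.{w} k where
  obj X := ModuleCat.of k (N X)
  map f := ModuleCat.ofHom ((M.map f).hom.restrict (h f))
  map_id X := by
    ext x
    exact congrArg (fun h => h.hom x.1) (M.map_id X)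
  map_comp f g := by
    ext x
    exact congrArg (fun h => h.hom x.1) (M.map_comp f g)

/-- The inclusion of a subfunctor. -/
def subfunctorOfι (M : A ⥤ ModuleCat.{w} k) (N : ∀ X, Submodule k (M.obj X))
    (h : ∀ {X Y : A} (f : X ⟶ Y), ∀ x ∈ N X, (M.map f).hom x ∈ N Y) :
    subfunctorOf M N h ⟶ M where
  app X := ModuleCat.ofHom (N X).subtype
  naturality _ _ _ := rfl

/-- The idempotent endomorphism onto `P` along `Q`, for complementary stable families of
subspaces. -/
def projAlong (M : A ⥤ ModuleCat.{w} k) (P Q : ∀ X, Submodule k (M.obj X))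
    (hPQ : ∀ X, IsCompl (P X) (Q X))
    (hP : ∀ {X Y : A} (f : X ⟶ Y), ∀ x ∈ P X, (M.map f).hom x ∈ P Y)
    (hQ : ∀ {X Y : A} (f : X ⟶ Y), ∀ x ∈ Q X, (M.map f).hom x ∈ Q Y) : M ⟶ M where
  app X := ModuleCat.ofHom ((P X).projection (Q X) (hPQ X))
  naturality X Y f := by
    ext x
    obtain ⟨p, hp, q, hq, rfl⟩ :=
      Submodule.mem_sup.1 ((hPQ X).sup_eq_top ▸ Submodule.mem_top : x ∈ P X ⊔ Q X)
    have h₁ := (Submodule.projection_apply_of_mem_left (hPQ X) hp)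
    have h₂ := (Submodule.projection_apply_of_mem_left (hPQ Y) (hP f p hp))
    have h₃ := (Submodule.projection_apply_of_mem_right (hPQ X) hq)
    have h₄ := (Submodule.projection_apply_of_mem_right (hPQ Y) (hQ f q hq))
    simp [h₁, h₂, h₃, h₄]

end Functors

/-! ### Direct sums of pointwise finite-dimensional representations -/

namespace PwfRep

variable {k : Type u₁} [Field k] {A : Type u₂} [Category.{v₁} A] [Preadditive A] [Linear k A]

instance (M : PwfRep.{w} k A) : M.obj.Additive := M.property.1

instance (M : PwfRep.{w} k A) : M.obj.Linear k := M.property.2.1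

instance (M : PwfRep.{w} k A) (X : A) : Module.Finite k (M.obj.obj X) := M.property.2.2 X

/-- Additivity and linearity are equations of maps, which may be checked after a pointwise injective
transformation. Hence summands split off in the abelian category of all functors stay in the
category of representations. -/
theorem isPwf_of_injective {M N : A ⥤ ModuleCat.{w} k} (hM : IsPwf.{w} k A M) (i : N ⟶ M)
    (hi : ∀ X, Function.Injective (i.app X).hom) : IsPwf.{w} k A N := by
  obtain ⟨hadd, hlin, hfin⟩ := hM
  refine ⟨⟨fun {X Y f g} => ?_⟩, ⟨fun {X Y} f r => ?_⟩, fun X => ?_⟩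
  · ext x
    apply hi Y
    rw [naturality_hom_apply, hadd.map_add]
    simp only [ModuleCat.hom_add, LinearMap.add_apply, map_add]
    rw [naturality_hom_apply, naturality_hom_apply]
  · ext x
    apply hi Y
    rw [naturality_hom_apply, hlin.map_smul]
    simp only [ModuleCat.hom_smul, LinearMap.smul_apply, map_smul]
    rw [naturality_hom_apply]
  · have := hfin X
    exact Module.Finite.of_injective _ (hi X)

theorem exists_isDirectSummand_of_idempotent (M : PwfRep.{w} k A) (e : M.obj ⟶ M.obj)
    (he : e ≫ e = e) :
    ∃ (N : PwfRep.{w} k A) (i : N.obj ⟶ M.obj) (p : M.obj ⟶ N.obj),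
      N.IsDirectSummand M ∧ i ≫ p = 𝟙 N.obj ∧ p ≫ i = e := by
  have := Idempotents.isIdempotentComplete_of_abelian (A ⥤ ModuleCat.{w} k)
  obtain ⟨Y, Y', i, p, i', p', hip, hpi, hip', hpi', hiso⟩ := exists_iso_biprod_of_idempotent e he
  exact ⟨⟨Y, isPwf_of_injective M.property i (injective_app_of_comp_eq_id hip)⟩, i, p,
    ⟨⟨Y', isPwf_of_injective M.property i' (injective_app_of_comp_eq_id hip')⟩, hiso⟩, hip, hpi⟩

theorem isIndecomposable_iff (M : PwfRep.{w} k A) :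
    M.IsIndecomposable ↔
      (∃ X, Nontrivial (M.obj.obj X)) ∧ ∀ e : M.obj ⟶ M.obj, e ≫ e = e → e = 0 ∨ e = 𝟙 M.obj := by
  have := Idempotents.isIdempotentComplete_of_abelian (A ⥤ ModuleCat.{w} k)
  have h : ¬ IsZero M.obj ↔ ∃ X, Nontrivial (M.obj.obj X) := by
    rw [isZero_functor_iff]
    simp only [not_forall, not_subsingleton_iff_nontrivial]
  rw [← h]
  exact indecomposable_iff_idempotent M.obj

section DirectSum

variable {Λ : Type u₃} {M : PwfRep.{w} k A} {V : Λ → PwfRep.{w} k A} {ι : ∀ i, V i ⟶ M}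

open scoped Classical in
/-- The bijection between the direct sum and `M` at an object. -/
def IsDirectSumVia.equiv (h : IsDirectSumVia M V ι) (X : A) :
    (DirectSum Λ fun i => (V i).obj.obj X) ≃ₗ[k] M.obj.obj X :=
  LinearEquiv.ofBijective _ (h X)

open scoped Classical in
theorem IsDirectSumVia.equiv_lof (h : IsDirectSumVia M V ι) (X : A) (i : Λ) (x : (V i).obj.obj X) :
    h.equiv X (DirectSum.lof k Λ (fun i => (V i).obj.obj X) i x) = ((ι i).hom.app X).hom x :=
  DirectSum.toModule_lof k (φ := fun i => ((ι i).hom.app X).hom) i x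

theorem IsDirectSumVia.induction (h : IsDirectSumVia M V ι) {X : A} {p : M.obj.obj X → Prop}
    (zero : p 0) (add : ∀ x y, p x → p y → p (x + y))
    (incl : ∀ i (x : (V i).obj.obj X), p (((ι i).hom.app X).hom x)) (x : M.obj.obj X) : p x := by
  classical
  obtain ⟨y, rfl⟩ := (h.equiv X).surjective x
  induction y using DirectSum.induction_on with
  | zero => rwa [map_zero]
  | of i x =>
    have := h.equiv_lof X i x
    rw [DirectSum.lof_eq_of] at this
    rw [this]
    exact incl i x
  | add x y hx hy =>
    rw [map_add]
    exact add _ _ hx hy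

open scoped Classical in
/-- The projection of a direct sum onto a summand. -/
def IsDirectSumVia.π (h : IsDirectSumVia M V ι) (j : Λ) : M.obj ⟶ (V j).obj where
  app X := ModuleCat.ofHom (DirectSum.component k Λ (fun i => (V i).obj.obj X) j ∘ₗ
    (h.equiv X).symm.toLinearMap)
  naturality X Y f := by
    ext x
    induction x using h.induction with
    | zero => simp only [map_zero]
    | add x y hx hy => simp only [map_add, hx, hy]
    | incl i x =>
      simp only [ModuleCat.hom_comp, LinearMap.comp_apply, ModuleCat.hom_ofHom,
        LinearEquiv.coe_coe]
      rw [← naturality_hom_apply (ι i).hom f x, ← h.equiv_lof, ← h.equiv_lof,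
        LinearEquiv.symm_apply_apply, LinearEquiv.symm_apply_apply,
        DirectSum.component.of, DirectSum.component.of]
      split_ifs with hij
      · subst hij
        rfl
      · rw [map_zero]

open scoped Classical in
theorem IsDirectSumVia.π_app_ι (h : IsDirectSumVia M V ι) (i j : Λ) {X : A}
    (x : (V i).obj.obj X) :
    ((h.π j).app X).hom (((ι i).hom.app X).hom x) = if e : i = j then e ▸ x else 0 := by
  have : ((h.π j).app X).hom (((ι i).hom.app X).hom x) =
    DirectSum.component k Λ (fun i => (V i).obj.obj X) j
      ((h.equiv X).symm (((ι i).hom.app X).hom x)) := rfl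
  rw [this, ← h.equiv_lof, LinearEquiv.symm_apply_apply, DirectSum.component.of]

theorem IsDirectSumVia.ι_π_self (h : IsDirectSumVia M V ι) (i : Λ) :
    (ι i).hom ≫ h.π i = 𝟙 (V i).obj :=
  natTrans_ext_hom fun X x => by
    rw [comp_app_apply, h.π_app_ι]
    simp

theorem IsDirectSumVia.ι_π_of_ne (h : IsDirectSumVia M V ι) {i j : Λ} (hij : i ≠ j) :
    (ι i).hom ≫ h.π j = 0 :=
  natTrans_ext_hom fun X x => by
    rw [comp_app_apply, h.π_app_ι, dif_neg hij]
    rfl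

theorem IsDirectSumVia.hom_ext (h : IsDirectSumVia M V ι) {N : A ⥤ ModuleCat.{w} k}
    {f g : M.obj ⟶ N} (H : ∀ i, (ι i).hom ≫ f = (ι i).hom ≫ g) : f = g :=
  natTrans_ext_hom fun X x => by
    induction x using h.induction with
    | zero => simp only [map_zero]
    | add x y hx hy => simp only [map_add, hx, hy]
    | incl i x => rw [← comp_app_apply, H, comp_app_apply]

/-- Non-zero vectors chosen from distinct summands are linearly independent in a finite-dimensional
space. This finiteness replaces finiteness of the index set throughout. -/
theorem IsDirectSumVia.finite_support (h : IsDirectSumVia M V ι) (X : A) :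
    {i | Nontrivial ((V i).obj.obj X)}.Finite := by
  classical
  choose v hv using fun i : {i | Nontrivial ((V i).obj.obj X)} =>
    @exists_ne _ i.2 (0 : (V i).obj.obj X)
  refine Set.finite_coe_iff.1 (LinearIndependent.finite_of_isNoetherian (R := k)
    (v := fun i : {i | Nontrivial ((V i).obj.obj X)} => ((ι i).hom.app X).hom (v i)) ?_)
  rw [linearIndependent_iff']
  intro s g hg i hi
  -- Projecting the relation to the i-th summand isolates its i-th coefficient.
  have H := congrArg ((h.π i).app X).hom hg
  rw [map_sum, map_zero, Finset.sum_eq_single_of_mem i hi, map_smul, ← comp_app_apply (ι i).hom,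
    h.ι_π_self] at H
  · exact (smul_eq_zero.1 H).resolve_right (hv i)
  · intro j _ hji
    rw [map_smul, ← comp_app_apply (ι j).hom, h.ι_π_of_ne (fun e => hji (Subtype.ext e))]
    exact smul_zero _

/-- At every object the composites `π j ≫ ι j` sum up to the identity; only those `j` contribute
for which `V j` does not vanish at the object. -/
theorem IsDirectSumVia.sum_ι_π (h : IsDirectSumVia M V ι) (X : A) (s : Finset Λ)
    (hs : ∀ i, Nontrivial ((V i).obj.obj X) → i ∈ s) (x : M.obj.obj X) :
    ∑ i ∈ s, ((ι i).hom.app X).hom (((h.π i).app X).hom x) = x := by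
  classical
  induction x using h.induction with
  | zero => simp only [map_zero, Finset.sum_const_zero]
  | add x y hx hy => simp only [map_add, Finset.sum_add_distrib, hx, hy]
  | incl i x =>
    have H : ∀ j ∈ s, j ≠ i → ((ι j).hom.app X).hom (((h.π j).app X).hom
        (((ι i).hom.app X).hom x)) = 0 := fun j _ hij => by
      rw [← comp_app_apply (ι i).hom, h.ι_π_of_ne hij.symm]
      exact map_zero _
    rcases subsingleton_or_nontrivial ((V i).obj.obj X) with hi | hi
    · rw [Subsingleton.elim x 0]
      simp only [map_zero, Finset.sum_const_zero]
    · rw [Finset.sum_eq_single_of_mem i (hs i hi) H, ← comp_app_apply (ι i).hom, h.ι_π_self]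
      rfl

end DirectSum

end PwfRep

/-! ### Decomposition into indecomposables -/

namespace Module.End

variable {k : Type*} [Field k] {V : Type*} [AddCommGroup V] [Module k V]

/-- An idempotent acts on a generalized eigenspace by zero or by the identity. -/
theorem apply_of_mem_maxGenEigenspace_of_idempotent {f : Module.End k V} (hf : f * f = f) (c : k)
    {v : V} (hv : v ∈ f.maxGenEigenspace c) : (c = 0 → f v = 0) ∧ (c ≠ 0 → f v = v) := by
  have hff : ∀ v, f (f v) = f v := fun v => LinearMap.congr_fun hf v
  have hdis : ∀ {a b : k}, a ≠ b → ∀ x, x ∈ f.maxGenEigenspace a → x ∈ f.maxGenEigenspace b →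
      x = 0 := fun hab x hx hx' =>
    Submodule.disjoint_def.1 (f.disjoint_genEigenspace hab ⊤ ⊤) x hx hx'
  have heig : ∀ {a : k} {x : V}, f x = a • x → x ∈ f.maxGenEigenspace a := fun {a x} h =>
    (f.genEigenspace a).monotone le_top (mem_eigenspace_iff.2 h)
  have hmaps : f v ∈ f.maxGenEigenspace c := mapsTo_maxGenEigenspace_of_comm rfl c hv
  -- Here f v is an eigenvector for 1 and v − f v one for 0, and both stay in the space for c.
  -- Spaces for different scalars meet in 0, which kills f v if c = 0 and v − f v if c ≠ 0.
  refine ⟨fun hc => ?_, fun hc => ?_⟩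
  · subst hc
    exact hdis zero_ne_one _ hmaps (heig (by rw [hff, one_smul]))
  · have : v - f v = 0 := hdis hc _ (Submodule.sub_mem _ hv hmaps)
      (heig (by rw [map_sub, hff, sub_self, zero_smul]))
    exact (sub_eq_zero.1 this).symm

theorem iSup_maxGenEigenspace_eq_top_of_idempotent {f : Module.End k V} (hf : f * f = f) :
    ⨆ c, f.maxGenEigenspace c = ⊤ := by
  have hff : ∀ v, f (f v) = f v := fun v => LinearMap.congr_fun hf v
  have heig : ∀ {a : k} {x : V}, f x = a • x → x ∈ ⨆ c, f.maxGenEigenspace c := fun {a x} h =>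
    (le_iSup (f.maxGenEigenspace ·) a)
      ((f.genEigenspace a).monotone le_top (mem_eigenspace_iff.2 h))
  refine eq_top_iff.2 fun v _ => ?_
  rw [← sub_add_cancel v (f v)]
  exact Submodule.add_mem _ (heig (a := 0) (by rw [map_sub, hff, sub_self, zero_smul]))
    (heig (a := 1) (by rw [hff, one_smul]))

end Module.End

namespace PwfRep

variable {k : Type u₁} [Field k] {A : Type u₂} [Category.{v₁} A]

/-- A maximal set of pairwise commuting idempotents. -/
theorem exists_maximal_commuting_idempotents {R : Type*} [Ring R] :
    ∃ E : Set R, (∀ e ∈ E, e * e = e) ∧ (∀ e ∈ E, ∀ f ∈ E, e * f = f * e) ∧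
      ∀ q : R, q * q = q → (∀ e ∈ E, q * e = e * q) → q ∈ E := by
  obtain ⟨E, hE⟩ := zorn_subset
    {E : Set R | (∀ e ∈ E, e * e = e) ∧ ∀ e ∈ E, ∀ f ∈ E, e * f = f * e} (fun c hc hch => by
      refine ⟨⋃₀ c, ⟨?_, ?_⟩, fun s hs => Set.subset_sUnion_of_mem hs⟩
      · rintro e ⟨s, hs, hes⟩
        exact (hc hs).1 e hes
      · rintro e ⟨s, hs, hes⟩ f ⟨t, ht, hft⟩
        rcases hch.total hs ht with h | h
        · exact (hc ht).2 e (h hes) f hft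
        · exact (hc hs).2 e hes f (h hft))
  refine ⟨E, hE.1.1, hE.1.2, fun q hq hqE => ?_⟩
  refine hE.2 (y := insert q E) ⟨?_, ?_⟩ (Set.subset_insert q E) (Set.mem_insert q E)
  · rintro e (rfl | he)
    · exact hq
    · exact hE.1.1 e he
  · rintro e (rfl | he) f (rfl | hf)
    · rfl
    · exact hqE f hf
    · exact (hqE e he).symm
    · exact hE.1.2 e he f hf

/-- The action of an endomorphism at an object. -/
def endApp (M : A ⥤ ModuleCat.{w} k) (e : End M) (X : A) : Module.End k (M.obj X) :=
  (e.app X).hom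

/-- The joint generalized eigenspaces of a set of endomorphisms. -/
def jointEigenspace (M : A ⥤ ModuleCat.{w} k) (E : Set (End M)) (χ : E → k) (X : A) :
    Submodule k (M.obj X) :=
  ⨅ e : E, (endApp M e X).maxGenEigenspace (χ e)

theorem map_mem_jointEigenspace (M : A ⥤ ModuleCat.{w} k) (E : Set (End M)) (χ : E → k) {X Y : A}
    (f : X ⟶ Y) (x : M.obj X) (hx : x ∈ jointEigenspace M E χ X) :
    (M.map f).hom x ∈ jointEigenspace M E χ Y := by
  simp only [jointEigenspace, Submodule.mem_iInf, Module.End.mem_maxGenEigenspace] at hx ⊢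
  intro e
  obtain ⟨n, hn⟩ := hx e
  refine ⟨n, ?_⟩
  have H : ∀ (n : ℕ) (x : M.obj X),
      (((endApp M e Y - χ e • (1 : Module.End k (M.obj Y))) ^ n) ((M.map f).hom x)) =
      (M.map f).hom (((endApp M e X - χ e • (1 : Module.End k (M.obj X))) ^ n) x) := by
    intro n
    induction n with
    | zero => intro x; rfl
    | succ n ih =>
      intro x
      rw [pow_succ, pow_succ, Module.End.mul_apply, Module.End.mul_apply, ← ih]
      congr 1
      have := naturality_hom_apply (M := M) (N := M) e.1 f x
      simp only [endApp, LinearMap.sub_apply, LinearMap.smul_apply, Module.End.one_apply, map_sub,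
        map_smul]
      rw [this]
  rw [H, hn, map_zero]

variable [Preadditive A] [Linear k A]

/-- The joint generalized eigenspaces as subrepresentations. -/
def jointEigenrep (M : PwfRep.{w} k A) (E : Set (End M.obj)) (χ : E → k) : PwfRep.{w} k A :=
  ⟨subfunctorOf M.obj (jointEigenspace M.obj E χ) (map_mem_jointEigenspace M.obj E χ),
    isPwf_of_injective M.property
      (subfunctorOfι M.obj (jointEigenspace M.obj E χ) (map_mem_jointEigenspace M.obj E χ))
      fun _ => Subtype.val_injective⟩

/-- The inclusion of a joint generalized eigenspace. -/
def jointEigenrepι (M : PwfRep.{w} k A) (E : Set (End M.obj)) (χ : E → k) :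
    jointEigenrep M E χ ⟶ M :=
  ⟨subfunctorOfι M.obj (jointEigenspace M.obj E χ) (map_mem_jointEigenspace M.obj E χ)⟩

theorem iSupIndep_jointEigenspace (M : PwfRep.{w} k A) {E : Set (End M.obj)}
    (hcomm : ∀ e ∈ E, ∀ f ∈ E, e * f = f * e) (X : A) :
    iSupIndep fun χ : E → k => jointEigenspace M.obj E χ X := by
  refine Module.End.independent_iInf_maxGenEigenspace_of_forall_mapsTo
    (fun e : E => endApp M.obj e X) fun e f c => Module.End.mapsTo_maxGenEigenspace_of_comm ?_ c
  exact congrArg (fun g : End M.obj => endApp M.obj g X) (hcomm f f.2 e e.2)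

/-- Simultaneous diagonalization of commuting idempotents on a finite-dimensional space; E may be
infinite. -/
theorem iSup_jointEigenspace (M : PwfRep.{w} k A) {E : Set (End M.obj)}
    (hE : ∀ e ∈ E, e * e = e) (hcomm : ∀ e ∈ E, ∀ f ∈ E, e * f = f * e) (X : A) :
    ⨆ χ : E → k, jointEigenspace M.obj E χ X = ⊤ := by
  refine Module.End.iSup_iInf_maxGenEigenspace_eq_top_of_iSup_maxGenEigenspace_eq_top_of_commute
    (fun e : E => endApp M.obj e X) (fun e f _ => ?_) fun e =>
      Module.End.iSup_maxGenEigenspace_eq_top_of_idempotent ?_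
  · exact congrArg (fun g : End M.obj => endApp M.obj g X) (hcomm e e.2 f f.2)
  · exact congrArg (fun g : End M.obj => endApp M.obj g X) (hE e e.2)

-- The index map c need only reach the characters with non-zero eigenrepresentation. It is used both
-- for all characters and for the non-vanishing ones alone.
open scoped Classical in
theorem isDirectSumVia_jointEigenrep (M : PwfRep.{w} k A) {E : Set (End M.obj)}
    (hE : ∀ e ∈ E, e * e = e) (hcomm : ∀ e ∈ E, ∀ f ∈ E, e * f = f * e)
    {Λ : Type u₃} (c : Λ → (E → k)) (hc : Function.Injective c)
    (hc' : ∀ χ, (∃ X, jointEigenspace M.obj E χ X ≠ ⊥) → χ ∈ Set.range c) :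
    IsDirectSumVia M (fun i => jointEigenrep M E (c i)) (fun i => jointEigenrepι M E (c i)) := by
  intro X
  refine DirectSum.isInternal_submodule_of_iSupIndep_of_iSup_eq_top
    (A := fun i => jointEigenspace M.obj E (c i) X)
    ((iSupIndep_jointEigenspace M hcomm X).comp hc) (eq_top_iff.2 ?_)
  rw [← iSup_jointEigenspace M hE hcomm X]
  refine iSup_le fun χ => ?_
  by_cases hχ : jointEigenspace M.obj E χ X = ⊥
  · rw [hχ]
    exact bot_le
  · obtain ⟨i, rfl⟩ := hc' χ ⟨X, hχ⟩
    exact le_iSup (fun i => jointEigenspace M.obj E (c i) X) i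

/-- An idempotent has no eigenvalues besides 0 and 1. If χ e is another scalar, the
eigenrepresentation is zero, so the second alternative may cover every χ e ≠ 0. -/
theorem jointEigenrepι_comp (M : PwfRep.{w} k A) {E : Set (End M.obj)}
    (hE : ∀ e ∈ E, e * e = e) (χ : E → k) (e : E) :
    (χ e = 0 → (jointEigenrepι M E χ).hom ≫ (e : End M.obj) = 0) ∧
      (χ e ≠ 0 → (jointEigenrepι M E χ).hom ≫ (e : End M.obj) = (jointEigenrepι M E χ).hom) := by
  have H : ∀ X (x : (jointEigenrep M E χ).obj.obj X), _ := fun X x =>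
    Module.End.apply_of_mem_maxGenEigenspace_of_idempotent (f := endApp M.obj e X)
      (congrArg (fun g : End M.obj => endApp M.obj g X) (hE e e.2)) (χ e)
      ((Submodule.mem_iInf _).1 x.2 e)
  exact ⟨fun h => natTrans_ext_hom fun X x => (H X x).1 h,
    fun h => natTrans_ext_hom fun X x => (H X x).2 h⟩

/-- An idempotent q of the χ-part, extended by zero to M, commutes with E, because each element of E
is 0 or 1 on every part. By maximality the extension belongs to E, so it is itself 0 or 1 on the
χ-part. -/
theorem isIndecomposable_jointEigenrep (M : PwfRep.{w} k A) {E : Set (End M.obj)}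
    (hE : ∀ e ∈ E, e * e = e) (hcomm : ∀ e ∈ E, ∀ f ∈ E, e * f = f * e)
    (hmax : ∀ q : End M.obj, q * q = q → (∀ e ∈ E, q * e = e * q) → q ∈ E)
    (χ : E → k) (hχ : ∃ X, jointEigenspace M.obj E χ X ≠ ⊥) :
    (jointEigenrep M E χ).IsIndecomposable := by
  rw [isIndecomposable_iff]
  refine ⟨hχ.imp fun X hX => (Submodule.nontrivial_iff_ne_bot).2 hX, fun q hq => ?_⟩
  have hsum := isDirectSumVia_jointEigenrep M hE hcomm (id : (E → k) → (E → k))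
    Function.injective_id fun χ _ => ⟨χ, rfl⟩
  -- The extension of q by zero on all other eigenrepresentations.
  let q' : End M.obj := hsum.π χ ≫ q ≫ (jointEigenrepι M E χ).hom
  have hself : (jointEigenrepι M E χ).hom ≫ q' = q ≫ (jointEigenrepι M E χ).hom := by
    have := hsum.ι_π_self χ
    exact (Category.assoc _ _ _).symm.trans ((congrArg (· ≫ _) this).trans (Category.id_comp _))
  have hne : ∀ ψ, ψ ≠ χ → (jointEigenrepι M E ψ).hom ≫ q' = 0 := fun ψ hψ => by
    have := hsum.ι_π_of_ne hψ
    exact (Category.assoc _ _ _).symm.trans ((congrArg (· ≫ _) this).trans zero_comp)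
  have hq' : q' ∈ E := by
    refine hmax q' ?_ fun e he => ?_
    · refine hsum.hom_ext fun ψ => ?_
      by_cases hψ : ψ = χ
      · subst hψ
        change (jointEigenrepι M E ψ).hom ≫ q' ≫ q' = (jointEigenrepι M E ψ).hom ≫ q'
        rw [reassoc_of% hself, hself, reassoc_of% hq]
      · change (jointEigenrepι M E ψ).hom ≫ q' ≫ q' = (jointEigenrepι M E ψ).hom ≫ q'
        rw [reassoc_of% hne ψ hψ, hne ψ hψ, zero_comp]
    · refine hsum.hom_ext fun ψ => ?_
      change (jointEigenrepι M E ψ).hom ≫ e ≫ q' = (jointEigenrepι M E ψ).hom ≫ q' ≫ e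
      have h := jointEigenrepι_comp M hE ψ ⟨e, he⟩
      by_cases hψ : ψ = χ
      · subst hψ
        rw [reassoc_of% hself]
        by_cases h0 : ψ ⟨e, he⟩ = 0
        · rw [reassoc_of% h.1 h0, h.1 h0, zero_comp, comp_zero]
        · rw [reassoc_of% h.2 h0, h.2 h0, hself]
      · rw [reassoc_of% hne ψ hψ, zero_comp]
        by_cases h0 : ψ ⟨e, he⟩ = 0
        · rw [reassoc_of% h.1 h0, zero_comp]
        · rw [reassoc_of% h.2 h0, hne ψ hψ]
  have hπ := hsum.ι_π_self χ
  change (jointEigenrepι M E χ).hom ≫ hsum.π χ = 𝟙 _ at hπ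
  have h := jointEigenrepι_comp M hE χ ⟨q', hq'⟩
  by_cases h0 : χ ⟨q', hq'⟩ = 0
  · left
    have h1 := h.1 h0
    change (jointEigenrepι M E χ).hom ≫ q' = 0 at h1
    rw [hself] at h1
    rw [← Category.comp_id q, ← hπ, reassoc_of% h1, zero_comp]
  · right
    have h1 := h.2 h0
    change (jointEigenrepι M E χ).hom ≫ q' = _ at h1
    rw [hself] at h1
    rw [← Category.comp_id q, ← hπ, reassoc_of% h1]

/-- Every pointwise finite-dimensional representation is a direct sum of indecomposables. -/
theorem exists_isDirectSum_indecomposable (M : PwfRep.{w} k A) :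
    ∃ (Λ : Type u₂) (W : Λ → PwfRep.{w} k A), (∀ i, (W i).IsIndecomposable) ∧ M.IsDirectSum W := by
  obtain ⟨E, hE, hcomm, hmax⟩ := exists_maximal_commuting_idempotents (R := End M.obj)
  let Λ₀ := {χ : E → k // ∃ X, jointEigenspace M.obj E χ X ≠ ⊥}
  have hfin : ∀ X, {χ : E → k | jointEigenspace M.obj E χ X ≠ ⊥}.Finite := fun X =>
    WellFoundedGT.finite_ne_bot_of_iSupIndep (iSupIndep_jointEigenspace M hcomm X)
  -- Each object supports only finitely many characters, so choosing an object where χ does not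
  -- vanish embeds Λ₀ into a family of finite sets indexed by A. This bounds the universe of the
  -- index set by that of the objects.
  have hsmall : Small.{u₂} Λ₀ := by
    have : ∀ X, Finite {χ : E → k | jointEigenspace M.obj E χ X ≠ ⊥} := hfin
    let g : Λ₀ → Σ X : A, {χ : E → k | jointEigenspace M.obj E χ X ≠ ⊥} := fun χ =>
      ⟨χ.2.choose, χ.1, χ.2.choose_spec⟩
    refine small_of_injective (f := g) fun χ ψ h => ?_
    have := congrArg (fun a : Σ X : A, {χ : E → k | jointEigenspace M.obj E χ X ≠ ⊥} => a.2.1) h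
    exact Subtype.ext this
  let s := (equivShrink.{u₂} Λ₀).symm
  refine ⟨Shrink.{u₂} Λ₀, fun i => jointEigenrep M E (s i).1, fun i =>
    isIndecomposable_jointEigenrep M hE hcomm hmax _ (s i).2,
    _, isDirectSumVia_jointEigenrep M hE hcomm (fun i => (s i).1)
      (Subtype.val_injective.comp s.injective) fun χ hχ => ?_⟩
  obtain ⟨i, hi⟩ := s.surjective ⟨χ, hχ⟩
  exact ⟨i, congrArg Subtype.val hi⟩

end PwfRep

/-! ### Local rings -/

namespace IsLocalRing

variable {R : Type*} [Ring R] [IsLocalRing R]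

/-- The idempotent ba or its complement is a unit, so ba is 1 or 0, and ba = 0 would force a = aba =
0. One-sided inverses being two-sided is what makes the non-units a two-sided ideal. -/
theorem mul_eq_one_symm_of_ring {a b : R} (h : a * b = 1) : b * a = 1 := by
  have hidem : b * a * (b * a) = b * a := by
    rw [mul_assoc, ← mul_assoc a, h, one_mul]
  rcases IsLocalRing.isUnit_or_isUnit_of_add_one (a := b * a) (b := 1 - b * a) (by abel)
    with hu | hu
  · exact hu.mul_left_cancel (by rw [hidem, mul_one])
  · have h0 : b * a = 0 := hu.mul_left_cancel (by rw [sub_mul, one_mul, hidem, sub_self, mul_zero])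
    have : a = 0 := by rw [← one_mul a, ← h, mul_assoc, h0, mul_zero]
    rw [this, zero_mul] at h
    exact absurd h zero_ne_one

theorem isUnit_right_of_isUnit_mul {a b : R} (h : IsUnit (a * b)) : IsUnit b := by
  obtain ⟨c, hc⟩ := h.exists_left_inv
  rw [← mul_assoc] at hc
  exact ⟨⟨b, c * a, mul_eq_one_symm_of_ring hc, hc⟩, rfl⟩

theorem isUnit_left_of_isUnit_mul {a b : R} (h : IsUnit (a * b)) : IsUnit a := by
  obtain ⟨c, hc⟩ := h.exists_right_inv
  rw [mul_assoc] at hc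
  exact ⟨⟨a, b * c, hc, mul_eq_one_symm_of_ring hc⟩, rfl⟩

variable (R) in
/-- The ideal of non-units of a (not necessarily commutative) local ring. -/
def nonunitsIdeal : Ideal R where
  carrier := nonunits R
  zero_mem' := not_isUnit_zero
  add_mem' {a b} ha hb hab := by
    obtain ⟨c, hc⟩ := hab.exists_left_inv
    rw [mul_add] at hc
    rcases IsLocalRing.isUnit_or_isUnit_of_add_one hc with h | h
    · exact ha (isUnit_right_of_isUnit_mul h)
    · exact hb (isUnit_right_of_isUnit_mul h)
  smul_mem' _ _ ha h := ha (isUnit_right_of_isUnit_mul h)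

instance : (nonunitsIdeal R).IsTwoSided where
  mul_mem_of_left _ ha h := ha (isUnit_left_of_isUnit_mul h)

/-- A matrix over a local ring that has a right inverse modulo non-units has at least as many
columns as rows. -/
theorem card_le_card_of_mul_sub_one_mem {S T : Type*} [Fintype S] [Fintype T] [DecidableEq S]
    (α : Matrix S T R) (β : Matrix T S R)
    (h : ∀ s t, (α * β) s t - (1 : Matrix S S R) s t ∈ nonunitsIdeal R) :
    Fintype.card S ≤ Fintype.card T := by
  have : Nontrivial (R ⧸ nonunitsIdeal R) := by
    refine Ideal.Quotient.nontrivial_iff.2 ((Ideal.ne_top_iff_one _).2 ?_)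
    exact fun h => h isUnit_one
  -- Modulo the non-units R becomes a division ring, where the hypothesis says that β is an exact
  -- right inverse of α. Then row vectors embed via v ↦ vα, and dimensions can be compared.
  let D : DivisionRing (R ⧸ nonunitsIdeal R) := DivisionRing.ofIsUnitOrEqZero fun a => by
    obtain ⟨a, rfl⟩ := Ideal.Quotient.mk_surjective a
    by_cases ha : IsUnit a
    · exact Or.inl (ha.map _)
    · exact Or.inr (Ideal.Quotient.eq_zero_iff_mem.2 ha)
  have hsr : StrongRankCondition (R ⧸ nonunitsIdeal R) := inferInstance
  let m := Ideal.Quotient.mk (nonunitsIdeal R)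
  have H : α.map m * β.map m = 1 := by
    ext s t
    rw [← Matrix.map_mul, ← Matrix.map_one m (map_zero m) (map_one m)]
    exact Ideal.Quotient.eq.2 (h s t)
  classical
  refine card_le_of_injective (R ⧸ nonunitsIdeal R)
    ((Matrix.toLinearMapRight' (α.map m) : (S → _) →ₗ[R ⧸ nonunitsIdeal R] (T → _)))
    (Function.LeftInverse.injective (g := Matrix.toLinearMapRight' (β.map m)) fun v => ?_)
  rw [Matrix.toLinearMapRight'_apply, Matrix.toLinearMapRight'_apply, Matrix.vecMul_vecMul, H,
    Matrix.vecMul_one]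

end IsLocalRing

/-! ### Endomorphism rings and uniqueness of decompositions -/

namespace PwfRep

variable {k : Type u₁} [Field k] {A : Type u₂} [Category.{v₁} A]

theorem endApp_pow_map (M : A ⥤ ModuleCat.{w} k) (f : End M) {X Y : A} (a : X ⟶ Y) (n : ℕ)
    (x : M.obj X) :
    ((endApp M f Y) ^ n) ((M.map a).hom x) = (M.map a).hom (((endApp M f X) ^ n) x) := by
  induction n generalizing x with
  | zero => rfl
  | succ n ih =>
    rw [pow_succ, pow_succ, Module.End.mul_apply, Module.End.mul_apply, ← ih]
    congr 1
    exact naturality_hom_apply (M := M) (N := M) f a x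

variable [Preadditive A] [Linear k A]

theorem isIso_of_injective_app {M : PwfRep.{w} k A} (f : M.obj ⟶ M.obj)
    (h : ∀ X, Function.Injective (f.app X).hom) : IsIso f :=
  isIso_of_bijective_app f fun X => ⟨h X, LinearMap.surjective_of_injective (h X)⟩

/-- The endomorphism ring of an indecomposable is local. -/
theorem isLocalRing_end {W : PwfRep.{w} k A} (hW : W.IsIndecomposable) :
    IsLocalRing (End W.obj) := by
  rw [isIndecomposable_iff] at hW
  obtain ⟨⟨X₀, hX₀⟩, hidem⟩ := hW
  have : Nontrivial (End W.obj) := by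
    refine ⟨⟨0, 1, fun h => ?_⟩⟩
    obtain ⟨x, hx⟩ := exists_ne (0 : W.obj.obj X₀)
    exact hx (congrArg (fun g : End W.obj => endApp W.obj g X₀ x) h).symm
  refine IsLocalRing.of_isUnit_or_isUnit_one_sub_self fun f => ?_
  -- Fitting's lemma at every object. No single power of f need work for all objects; the union of
  -- kernels and the intersection of images avoid choosing one and are stable under the action.
  let e : W.obj ⟶ W.obj := projAlong W.obj (fun X => ⨆ n, LinearMap.ker (endApp W.obj f X ^ n))
    (fun X => ⨅ n, LinearMap.range (endApp W.obj f X ^ n))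
    (fun X => LinearMap.isCompl_iSup_ker_pow_iInf_range_pow _)
    (fun {X Y} a => by
      suffices H : (⨆ n, LinearMap.ker (endApp W.obj f X ^ n)) ≤
          (⨆ n, LinearMap.ker (endApp W.obj f Y ^ n)).comap (W.obj.map a).hom from H
      refine iSup_le fun n x hx => Submodule.mem_iSup_of_mem n ?_
      rw [LinearMap.mem_ker] at hx ⊢
      rw [endApp_pow_map, hx, map_zero])
    (fun {X Y} a x hx => by
      rw [Submodule.mem_iInf] at hx ⊢
      intro n
      obtain ⟨y, hy⟩ := hx n
      exact ⟨(W.obj.map a).hom y, by rw [endApp_pow_map, hy]⟩)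
  have happ : ∀ X x, (e.app X).hom x = Submodule.projection _ _
      (LinearMap.isCompl_iSup_ker_pow_iInf_range_pow (endApp W.obj f X)) x := fun X x => rfl
  have he : e ≫ e = e := natTrans_ext_hom fun X x => by
    rw [comp_app_apply, happ, happ]
    exact LinearMap.congr_fun (Submodule.isIdempotentElem_projection
      (LinearMap.isCompl_iSup_ker_pow_iInf_range_pow (endApp W.obj f X))) x
  rcases hidem e he with h | h
  -- If e = 0, then f has no kernel at any object, so f is invertible by finite dimension.
  · left
    rw [isUnit_iff_isIso]
    refine isIso_of_injective_app _ fun X => ?_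
    refine (injective_iff_map_eq_zero _).2 fun x hx => ?_
    have h₁ : x ∈ ⨆ n, LinearMap.ker (endApp W.obj f X ^ n) :=
      Submodule.mem_iSup_of_mem 1 (by rw [pow_one]; exact hx)
    rw [← Submodule.projection_apply_of_mem_left
      (LinearMap.isCompl_iSup_ker_pow_iInf_range_pow (endApp W.obj f X)) h₁, ← happ, h]
    rfl
  -- If e = 1, then f is nilpotent at every object. A vector killed by 1 − f is fixed by all powers
  -- of f and hence is zero.
  · right
    rw [isUnit_iff_isIso]
    refine isIso_of_injective_app _ fun X => ?_
    refine (injective_iff_map_eq_zero _).2 fun x hx => ?_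
    have h₁ : x ∈ ⨆ n, LinearMap.ker (endApp W.obj f X ^ n) := by
      have := Submodule.projection_apply_mem
        (LinearMap.isCompl_iSup_ker_pow_iInf_range_pow (endApp W.obj f X)) x
      rw [← happ, h] at this
      exact this
    have hfx : endApp W.obj f X x = x := (sub_eq_zero.1 hx).symm
    have hpow : ∀ n, (endApp W.obj f X ^ n) x = x := fun n => by
      induction n with
      | zero => rfl
      | succ n ih => rw [pow_succ, Module.End.mul_apply, hfx, ih]
    have hmono : Monotone fun n => LinearMap.ker (endApp W.obj f X ^ n) := fun m n hmn y hy => by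
      rw [LinearMap.mem_ker] at hy ⊢
      rw [← Nat.sub_add_cancel hmn, pow_add, Module.End.mul_apply, hy, map_zero]
    obtain ⟨n, hn⟩ := (Submodule.mem_iSup_of_directed _ hmono.directed_le).1 h₁
    rw [← hpow n]
    exact hn

/-- The composite g (f g)⁻¹ f, in diagrammatic order, is an idempotent of V. It is not 0, since that
would give f g = 0 and W = 0, so it is 1 and provides the missing one-sided inverse. -/
theorem isIso_of_isIso_comp {W V : PwfRep.{w} k A} (hW : W.IsIndecomposable)
    (hV : V.IsIndecomposable) (f : W.obj ⟶ V.obj) (g : V.obj ⟶ W.obj) [IsIso (f ≫ g)] :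
    IsIso f := by
  rw [isIndecomposable_iff] at hV
  rcases hV.2 (g ≫ inv (f ≫ g) ≫ f) (by
    have := IsIso.hom_inv_id (f ≫ g)
    simp only [Category.assoc] at this ⊢
    rw [reassoc_of% this]) with h | h
  · exfalso
    have h0 : f ≫ g = 0 := by
      have : (f ≫ g) ≫ inv (f ≫ g) ≫ (f ≫ g) = f ≫ g := by simp
      rw [← this]
      have h' : f ≫ (g ≫ inv (f ≫ g) ≫ f) ≫ g = 0 := by rw [h, zero_comp, comp_zero]
      simpa only [Category.assoc] using h'
    refine hW.1 ((IsZero.iff_id_eq_zero _).2 ?_)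
    rw [← IsIso.hom_inv_id (f ≫ g)]
    exact (congrArg (· ≫ inv (f ≫ g)) h0).trans zero_comp
  · exact ⟨g ≫ inv (f ≫ g), by rw [← Category.assoc, IsIso.hom_inv_id], by
      rw [Category.assoc, h]⟩

/-- Isomorphisms of the underlying functors are isomorphisms of representations. -/
def isoMk {M N : PwfRep.{w} k A} (e : M.obj ≅ N.obj) : M ≅ N :=
  (ObjectProperty.ι _).preimageIso e

theorem nonempty_iso_of_isUnit_comp {W V : PwfRep.{w} k A} (hW : W.IsIndecomposable)
    (hV : V.IsIndecomposable) (f : W.obj ⟶ V.obj) (g : V.obj ⟶ W.obj)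
    (h : IsUnit (M := End W.obj) (f ≫ g)) : Nonempty (W ≅ V) := by
  have := (isUnit_iff_isIso _).1 h
  have := isIso_of_isIso_comp hW hV f g
  exact ⟨isoMk (asIso f)⟩

theorem isIndecomposable_of_iso {U U' : PwfRep.{w} k A} (e : U ≅ U') (h : U'.IsIndecomposable) :
    U.IsIndecomposable := by
  have i : U.obj ≅ U'.obj := (ObjectProperty.ι _).mapIso e
  exact ⟨fun hz => h.1 (hz.of_iso i.symm), fun Y Z f => h.2 Y Z (i.symm ≪≫ f)⟩

section

variable {M U : PwfRep.{w} k A} {Λ : Type u₃} {Λ' : Type u₄} {W : Λ → PwfRep.{w} k A}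
  {V : Λ' → PwfRep.{w} k A} {ι : ∀ i, W i ⟶ M} {κ : ∀ j, V j ⟶ M}

theorem IsDirectSumVia.finite_iso (h : IsDirectSumVia M W ι) (hU : U.IsIndecomposable) :
    Finite {i // Nonempty (U ≅ W i)} := by
  obtain ⟨X, hX⟩ := ((isIndecomposable_iff U).1 hU).1
  refine Set.Finite.subset (h.finite_support X) ?_
  rintro i ⟨e⟩
  exact (bijective_app_of_isIso e.hom.hom X).injective.nontrivial

/-- Let S and T index the copies of U in the two decompositions. The components of the identity of M
between these copies form matrices B and C over the local ring End U. The summands V j not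
isomorphic to U contribute only non-units, so BC ≡ 1 modulo non-units and |S| ≤ |T|. -/
theorem IsDirectSumVia.natCard_iso_le (h : IsDirectSumVia M W ι) (h' : IsDirectSumVia M V κ)
    (hV : ∀ j, (V j).IsIndecomposable) (hU : U.IsIndecomposable) :
    Nat.card {i // Nonempty (U ≅ W i)} ≤ Nat.card {j // Nonempty (U ≅ V j)} := by
  classical
  have := isLocalRing_end hU
  have := h.finite_iso hU
  have := h'.finite_iso hU
  have := Fintype.ofFinite {i // Nonempty (U ≅ W i)}
  have := Fintype.ofFinite {j // Nonempty (U ≅ V j)}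
  obtain ⟨X, hX⟩ := ((isIndecomposable_iff U).1 hU).1
  let S := {i // Nonempty (U ≅ W i)}
  let T := {j // Nonempty (U ≅ V j)}
  let θ : ∀ i : S, U ≅ W i := fun i => i.2.some
  let φ : ∀ j : T, U ≅ V j := fun j => j.2.some
  let a : S → (U.obj ⟶ M.obj) := fun s => (θ s).hom.hom ≫ (ι s).hom
  let b : S → (M.obj ⟶ U.obj) := fun s => h.π s ≫ (θ s).inv.hom
  have hab : ∀ s t, a s ≫ b t = if s = t then 𝟙 U.obj else 0 := by
    intro s t
    split_ifs with hst
    · subst hst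
      have := h.ι_π_self s.1
      simp only [a, b, Category.assoc, reassoc_of% this]
      rw [← ObjectProperty.FullSubcategory.comp_hom, Iso.hom_inv_id]
      rfl
    · have := h.ι_π_of_ne (i := s.1) (j := t.1) fun e => hst (Subtype.ext e)
      simp only [a, b, Category.assoc, reassoc_of% this, zero_comp, comp_zero]
  rw [Nat.card_eq_fintype_card, Nat.card_eq_fintype_card]
  let B : Matrix S T (End U.obj) := fun t j => ((φ j).hom.hom ≫ (κ j).hom ≫ b t : U.obj ⟶ U.obj)
  let C : Matrix T S (End U.obj) := fun j s => (a s ≫ h'.π j ≫ (φ j).inv.hom : U.obj ⟶ U.obj)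
  let D : S → S → Λ' → End U.obj := fun t s j => (a s ≫ h'.π j ≫ (κ j).hom ≫ b t : U.obj ⟶ U.obj)
  have hBC : ∀ t s j, B t j * C j s = D t s j := fun t s j => by
    change (a s ≫ h'.π j ≫ (φ j).inv.hom) ≫ ((φ j).hom.hom ≫ (κ j).hom ≫ b t) = _
    have : (φ j).inv.hom ≫ (φ j).hom.hom = 𝟙 _ := by
      rw [← ObjectProperty.FullSubcategory.comp_hom, Iso.inv_hom_id]
      rfl
    simp only [Category.assoc, reassoc_of% this]
    rfl
  refine IsLocalRing.card_le_card_of_mul_sub_one_mem B C fun t s => ?_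
  have hone : (1 : Matrix S S (End U.obj)) t s = (a s ≫ b t : U.obj ⟶ U.obj) := by
    rw [hab, Matrix.one_apply]
    by_cases hst : t = s
    · rw [if_pos hst, if_pos hst.symm]
      rfl
    · rw [if_neg hst, if_neg (Ne.symm hst)]
  rw [hone, Matrix.mul_apply]
  simp only [hBC]
  -- The sum of π j ≫ κ j over all j makes sense only at one object at a time. F contains every
  -- summand visible at X, where U is non-zero, and all of T.
  let F : Finset Λ' := (h'.finite_support X).toFinset ∪ Finset.univ.image (Subtype.val : T → Λ')
  have hsum : ∑ j : T, D t s j =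
      ∑ j ∈ F, D t s j - ∑ j ∈ F.filter (fun j => ¬ Nonempty (U ≅ V j)), D t s j := by
    rw [← Finset.sum_filter_add_sum_filter_not F (fun j => Nonempty (U ≅ V j)),
      add_sub_cancel_right]
    refine (Finset.sum_subtype _ (fun j => ?_) _).symm
    simp only [Finset.mem_filter, F, Finset.mem_union, Finset.mem_image, Finset.mem_univ, true_and]
    exact ⟨fun hj => hj.2, fun hj => ⟨Or.inr ⟨⟨j, hj⟩, rfl⟩, hj⟩⟩
  rw [hsum, sub_right_comm]
  refine Submodule.sub_mem _ ?_ (Submodule.sum_mem _ fun j hj => ?_)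
  -- The sum over F equals a s ≫ b t at X, so the difference vanishes at X. There U is non-zero,
  -- hence the difference is not a unit, whatever it does at other objects.
  · intro hunit
    have hiso := (isUnit_iff_isIso _).1 hunit
    have hbij := (@bijective_app_of_isIso _ _ _ _ U.obj U.obj _ hiso X).injective
    obtain ⟨x, hx⟩ := exists_ne (0 : U.obj.obj X)
    refine hx (hbij ?_)
    rw [map_zero]
    let ev : End U.obj →+ U.obj.obj X :=
      { toFun := fun g => endApp U.obj g X x, map_zero' := rfl, map_add' := fun _ _ => rfl }
    change ev (∑ j ∈ F, D t s j - (show End U.obj from a s ≫ b t)) = 0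
    rw [map_sub, map_sum, sub_eq_zero]
    have key := h'.sum_ι_π X F (fun i hi => Finset.mem_union_left _
      ((h'.finite_support X).mem_toFinset.2 hi)) (((a s).app X).hom x)
    have := congrArg ((b t).app X).hom key
    rw [map_sum] at this
    exact this
  · intro hunit
    exact (Finset.mem_filter.1 hj).2 (nonempty_iso_of_isUnit_comp hU (hV j)
      (a s ≫ h'.π j) ((κ j).hom ≫ b t) (by simpa only [Category.assoc] using hunit))

end

/-- The decomposition into indecomposables is unique up to isomorphism. -/
theorem exists_equiv_of_isDirectSum {M : PwfRep.{w} k A} {Λ : Type u₃} {Λ' : Type u₄}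
    {W : Λ → PwfRep.{w} k A} {V : Λ' → PwfRep.{w} k A} (hW : ∀ i, (W i).IsIndecomposable)
    (hV : ∀ j, (V j).IsIndecomposable) (hMW : M.IsDirectSum W) (hMV : M.IsDirectSum V) :
    ∃ σ : Λ ≃ Λ', ∀ i, Nonempty (W i ≅ V (σ i)) := by
  obtain ⟨ι, h⟩ := hMW
  obtain ⟨κ, h'⟩ := hMV
  let cls : PwfRep.{w} k A → Quotient (isIsomorphicSetoid (PwfRep.{w} k A)) := Quotient.mk _
  have hcls : ∀ U U', cls U' = cls U ↔ Nonempty (U ≅ U') := fun U U' =>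
    ⟨fun e => ⟨(Quotient.exact e).some.symm⟩, fun ⟨e⟩ => Quotient.sound ⟨e.symm⟩⟩
  have key : ∀ U : PwfRep.{w} k A,
      Nonempty ({i // cls (W i) = cls U} ≃ {j // cls (V j) = cls U}) := by
    intro U
    simp only [hcls]
    have aux : U.IsIndecomposable →
        Nonempty ({i // Nonempty (U ≅ W i)} ≃ {j // Nonempty (U ≅ V j)}) := fun hU => by
      have := h.finite_iso hU
      have := h'.finite_iso hU
      exact ⟨(Finite.equivFin _).trans ((finCongr (le_antisymm (h.natCard_iso_le h' hV hU)
        (h'.natCard_iso_le h hW hU))).trans (Finite.equivFin _).symm)⟩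
    by_cases h₁ : Nonempty {i // Nonempty (U ≅ W i)}
    · obtain ⟨i, hi⟩ := h₁
      exact aux (isIndecomposable_of_iso hi.some (hW i))
    by_cases h₂ : Nonempty {j // Nonempty (U ≅ V j)}
    · obtain ⟨j, hj⟩ := h₂
      exact aux (isIndecomposable_of_iso hj.some (hV j))
    rw [not_nonempty_iff] at h₁ h₂
    exact ⟨Equiv.equivOfIsEmpty _ _⟩
  -- The indices are matched one isomorphism class at a time, and the bijections of the fibres are
  -- glued.
  have key' : ∀ c, Nonempty ({i // cls (W i) = c} ≃ {j // cls (V j) = c}) := by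
    rintro ⟨U⟩
    exact key U
  refine ⟨Equiv.ofFiberEquiv fun c => (key' c).some, fun i => ?_⟩
  rw [← hcls]
  exact Equiv.ofFiberEquiv_map (f := fun i => cls (W i)) (g := fun j => cls (V j)) _ i

end PwfRep

/-! ### Systems of vector spaces on a linear order -/

section LinearSystem

variable {k : Type*} [Field k]

/-- The quotient by the kernel of f embeds in V', and over a field this embedding has a left
inverse. -/
theorem LinearMap.exists_comp_eq_of_ker_le {V V' : Type*} [AddCommGroup V] [Module k V]
    [AddCommGroup V'] [Module k V'] (f : V →ₗ[k] V') (φ : V →ₗ[k] k)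
    (h : LinearMap.ker f ≤ LinearMap.ker φ) : ∃ ψ : V' →ₗ[k] k, ψ ∘ₗ f = φ := by
  obtain ⟨g, hg⟩ := LinearMap.exists_leftInverse_of_injective
    ((LinearMap.ker f).liftQ f le_rfl) (Submodule.ker_liftQ_eq_bot _ _ _ le_rfl)
  refine ⟨(LinearMap.ker f).liftQ φ h ∘ₗ g, ?_⟩
  ext v
  have : g (f v) = (LinearMap.ker f).mkQ v := LinearMap.congr_fun hg ((LinearMap.ker f).mkQ v)
  simp [this]

variable {P : Type*} [LinearOrder P] {V : P → Type*} [∀ x, AddCommGroup (V x)]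
  [∀ x, Module k (V x)] (η : ∀ x y, x ≤ y → V x →ₗ[k] V y)

/-- A functional at `x₀` that kills the kernels of all `V x₀ → V y`, for `y` in a set `U` above
`x₀`, extends compatibly to all of `U`. -/
theorem exists_compatible_functionals (hid : ∀ x (v : V x), η x x le_rfl v = v)
    (hcomp : ∀ x y z (h : x ≤ y) (h' : y ≤ z) (v : V x),
      η y z h' (η x y h v) = η x z (h.trans h') v)
    {x₀ : P} {U : Set P} (hx₀ : x₀ ∈ U) (hU : ∀ y ∈ U, x₀ ≤ y) (φ : V x₀ →ₗ[k] k)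
    (hφ : ∀ y (hy : y ∈ U) (v : V x₀), η x₀ y (hU y hy) v = 0 → φ v = 0) :
    ∃ ψ : ∀ y, V y →ₗ[k] k, ψ x₀ = φ ∧
      ∀ y ∈ U, ∀ z ∈ U, ∀ (h : y ≤ z) (v : V y), ψ z (η y z h v) = ψ y v := by
  classical
  let G : U → Type _ := fun y => V y
  let f : ∀ i j : U, i ≤ j → G i →ₗ[k] G j := fun i j h => η i j h
  have : DirectedSystem G fun i j h => f i j h :=
    { map_self := fun i v => hid i.1 v
      map_map := fun l j i hij hjl v => hcomp i.1 j.1 l.1 hij hjl v }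
  let o : U := ⟨x₀, hx₀⟩
  -- A vector that dies in the direct limit already dies in some V y, so φ kills it and factors
  -- through the limit. Pulling the factor back to each V y is automatically compatible.
  obtain ⟨Ψ, hΨ⟩ := LinearMap.exists_comp_eq_of_ker_le (Module.DirectLimit.of k U G f o) φ (by
    intro v hv
    obtain ⟨j, hj, h0⟩ := Module.DirectLimit.of.zero_exact (LinearMap.mem_ker.1 hv)
    exact hφ j j.2 v h0)
  refine ⟨fun y => if hy : y ∈ U then Ψ ∘ₗ Module.DirectLimit.of k U G f ⟨y, hy⟩ else 0, ?_, ?_⟩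
  · simp only [dif_pos hx₀]
    exact hΨ
  · intro y hy z hz h v
    simp only [dif_pos hy, dif_pos hz]
    exact congrArg Ψ (Module.DirectLimit.of_f (G := G) (f := f) (i := ⟨y, hy⟩) (j := ⟨z, hz⟩)
      (hij := h) (x := v))

/-- A vector at `x₀` that lies in the image of all `V y → V x₀`, for `y` in a set `U` below `x₀`,
lifts compatibly to all of `U`. -/
theorem exists_compatible_vectors [∀ x, FiniteDimensional k (V x)]
    (hid : ∀ x (v : V x), η x x le_rfl v = v)
    (hcomp : ∀ x y z (h : x ≤ y) (h' : y ≤ z) (v : V x),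
      η y z h' (η x y h v) = η x z (h.trans h') v)
    {x₀ : P} {U : Set P} (hx₀ : x₀ ∈ U) (hU : ∀ y ∈ U, y ≤ x₀) (v : V x₀)
    (hv : ∀ y (hy : y ∈ U), v ∈ LinearMap.range (η y x₀ (hU y hy))) :
    ∃ u : ∀ y, V y, u x₀ = v ∧
      ∀ y ∈ U, ∀ z ∈ U, ∀ h : y ≤ z, η y z h (u y) = u z := by
  -- The dual spaces form a system on the reversed order, where v is a functional. Lying in the
  -- image of η means killing the kernel of its transpose, and finite dimension turns functionals on
  -- duals back into vectors.
  obtain ⟨ψ, h₁, h₂⟩ := exists_compatible_functionals (P := Pᵒᵈ)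
    (V := fun x => Module.Dual k (V x.ofDual)) (fun x y h => (η y.ofDual x.ofDual h).dualMap)
    (fun x ξ => LinearMap.ext fun v => congrArg ξ (hid x.ofDual v))
    (fun x y z h h' ξ => LinearMap.ext fun v =>
      congrArg ξ (hcomp z.ofDual y.ofDual x.ofDual h' h v))
    (x₀ := OrderDual.toDual x₀) (U := OrderDual.ofDual ⁻¹' U) hx₀ hU
    (Module.evalEquiv k (V x₀) v) (by
      intro y hy ξ hξ
      obtain ⟨w, rfl⟩ := hv y hy
      exact LinearMap.congr_fun hξ w)
  choose u hu using fun y : P => (Module.evalEquiv k (V y)).surjective (ψ (OrderDual.toDual y))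
  have hu' : ∀ y (ξ : Module.Dual k (V y)), ξ (u y) = ψ (OrderDual.toDual y) ξ := fun y ξ =>
    LinearMap.congr_fun (hu y) ξ
  refine ⟨u, (Module.evalEquiv k (V x₀)).injective ((hu x₀).trans h₁), fun y hy z hz h =>
    (Module.evalEquiv k (V z)).injective (LinearMap.ext fun ξ => ?_)⟩
  change ξ (η y z h (u y)) = ξ (u z)
  rw [hu' z, ← h₂ (OrderDual.toDual z) hz (OrderDual.toDual y) hy h ξ]
  exact hu' y (ξ ∘ₗ η y z h)

/-- If `v` is killed by a map out of the system but does not come from a map into the system, then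
some interval module through `x₀` that does not meet these maps is a direct summand of the
system. -/
theorem exists_idempotent_of_not_ker_le_range [∀ x, FiniteDimensional k (V x)]
    (hid : ∀ x (v : V x), η x x le_rfl v = v)
    (hcomp : ∀ x y z (h : x ≤ y) (h' : y ≤ z) (v : V x),
      η y z h' (η x y h v) = η x z (h.trans h') v)
    {A B : Type*} [AddCommGroup A] [Module k A] [AddCommGroup B] [Module k B]
    (a : ∀ x, A →ₗ[k] V x) (ha : ∀ x y (h : x ≤ y) (v : A), η x y h (a x v) = a y v)
    (b : ∀ x, V x →ₗ[k] B) (hb : ∀ x y (h : x ≤ y) (v : V x), b y (η x y h v) = b x v)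
    (x₀ : P) (hx₀ : ¬ LinearMap.ker (b x₀) ≤ LinearMap.range (a x₀)) :
    ∃ e : ∀ x, V x →ₗ[k] V x, (∀ x y (h : x ≤ y) (v : V x), η x y h (e x v) = e y (η x y h v)) ∧
      (∀ x v, e x (e x v) = e x v) ∧ (∀ x v, e x (a x v) = 0) ∧ (∀ x v, b x (e x v) = 0) ∧
      e x₀ ≠ 0 := by
  classical
  -- Images from below and kernels towards above give two chains of subspaces of V x₀. All F contain
  -- the image of a, and all G lie in the kernel of b.
  let F : ∀ x, x ≤ x₀ → Submodule k (V x₀) := fun x h => LinearMap.range (η x x₀ h)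
  let G : ∀ y, x₀ ≤ y → Submodule k (V x₀) := fun y h => LinearMap.ker (η x₀ y h)
  let Fa := LinearMap.range (a x₀)
  have hFmono : ∀ x y (h : x ≤ y) (hy : y ≤ x₀), F x (h.trans hy) ≤ F y hy := by
    rintro x y h hy _ ⟨v, rfl⟩
    exact ⟨η x y h v, hcomp _ _ _ _ _ _⟩
  have hGmono : ∀ x y (h : x ≤ y) (hx : x₀ ≤ x), G x hx ≤ G y (hx.trans h) := by
    intro x y h hx v hv
    rw [LinearMap.mem_ker] at hv ⊢
    rw [← hcomp _ _ _ hx h, hv, map_zero]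
  have hFa : ∀ x h, Fa ≤ F x h := by
    rintro x h _ ⟨v, rfl⟩
    exact ⟨a x v, ha _ _ _ _⟩
  have hGb : ∀ y h, G y h ≤ LinearMap.ker (b x₀) := by
    intro y h v hv
    rw [LinearMap.mem_ker] at hv ⊢
    rw [← hb x₀ y h, hv, map_zero]
  -- G₀ is the smallest of the G y and ker b that is not inside the image of a. It fixes the upper
  -- end of the interval; ker b is included to make the collection non-empty.
  obtain ⟨G₀, hG₀, hG₀a, hG₀min⟩ : ∃ G₀ : Submodule k (V x₀),
      G₀ ≤ LinearMap.ker (b x₀) ∧ ¬ G₀ ≤ Fa ∧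
        (∀ y h, ¬ G₀ ≤ G y h → G y h ≤ Fa) := by
    obtain ⟨G₀, hG₀, hmin⟩ := WellFounded.has_min (wellFounded_lt (α := Submodule k (V x₀)))
      {K | (K = LinearMap.ker (b x₀) ∨ ∃ y h, K = G y h) ∧ ¬ K ≤ Fa} ⟨_, Or.inl rfl, hx₀⟩
    have htot : ∀ y h, G₀ ≤ G y h ∨ G y h ≤ G₀ := by
      intro y h
      rcases hG₀.1 with rfl | ⟨z, hz, rfl⟩
      · exact Or.inr (hGb y h)
      · rcases le_total y z with hyz | hyz
        · exact Or.inr (hGmono _ _ hyz _)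
        · exact Or.inl (hGmono _ _ hyz _)
    have htot' : ∀ y h, G₀ ≤ G y h ∨ G y h < G₀ := fun y h => by
      rcases htot y h with h' | h'
      · exact Or.inl h'
      · exact (em _).imp id fun h'' => lt_of_le_not_ge h' h''
    refine ⟨G₀, ?_, hG₀.2, fun y h hy => ?_⟩
    · rcases hG₀.1 with rfl | ⟨z, hz, rfl⟩
      · exact le_rfl
      · exact hGb z hz
    · by_contra hcon
      exact hmin _ ⟨Or.inr ⟨y, h, rfl⟩, hcon⟩ ((htot' y h).resolve_left hy)
  -- F₀ is the smallest image whose intersection with G₀ still leaves the image of a; it fixes the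
  -- lower end. A vector v of F₀ ∩ G₀ outside that image generates the interval module.
  obtain ⟨F₀, hF₀a, hF₀min⟩ : ∃ F₀ : Submodule k (V x₀), ¬ F₀ ⊓ G₀ ≤ Fa ∧
      (∀ x h, ¬ F₀ ≤ F x h → F x h ⊓ G₀ ≤ Fa) := by
    obtain ⟨F₀, hF₀, hmin⟩ := WellFounded.has_min (wellFounded_lt (α := Submodule k (V x₀)))
      {K | (∃ x h, K = F x h) ∧ ¬ K ⊓ G₀ ≤ Fa} ⟨_, ⟨x₀, le_rfl, rfl⟩, fun h => hG₀a fun v hv =>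
        h ⟨⟨v, hid _ _⟩, hv⟩⟩
    refine ⟨F₀, hF₀.2, fun x h hx => ?_⟩
    by_contra hcon
    refine hmin _ ⟨⟨x, h, rfl⟩, hcon⟩ (lt_of_le_not_ge ?_ hx)
    obtain ⟨z, hz, rfl⟩ := hF₀.1
    rcases le_total x z with hxz | hxz
    · exact hFmono _ _ hxz _
    · exact absurd (hFmono _ _ hxz _) hx
  obtain ⟨v, ⟨hvF, hvG⟩, hva⟩ := Set.not_subset.1 hF₀a
  -- K is the largest among the image of a and the images F x not containing F₀. As v is not in K,
  -- some functional φ has φ(v) = 1 and φ(K) = 0; it will cut out the complement of the interval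
  -- module.
  obtain ⟨K, hKa, hKF, hKG⟩ : ∃ K : Submodule k (V x₀), Fa ≤ K ∧
      (∀ x h, ¬ F₀ ≤ F x h → F x h ≤ K) ∧ K ⊓ G₀ ≤ Fa := by
    obtain ⟨K, hK, hmax⟩ := WellFounded.has_min (wellFounded_gt (α := Submodule k (V x₀)))
      {K | K = Fa ∨ ∃ x h, K = F x h ∧ ¬ F₀ ≤ F x h} ⟨Fa, Or.inl rfl⟩
    refine ⟨K, ?_, fun x h hx => ?_, ?_⟩
    · rcases hK with rfl | ⟨x, h, rfl, -⟩
      · exact le_rfl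
      · exact hFa x h
    · by_contra hcon
      refine hmax _ (Or.inr ⟨x, h, rfl, hx⟩) (lt_of_le_not_ge ?_ hcon)
      rcases hK with rfl | ⟨y, hy, rfl, -⟩
      · exact hFa x h
      · rcases le_total x y with hxy | hxy
        · exact absurd (hFmono _ _ hxy _) hcon
        · exact hFmono _ _ hxy _
    · rcases hK with rfl | ⟨x, h, rfl, hx⟩
      · exact inf_le_left
      · exact hF₀min x h hx
  have hvK : v ∉ K := fun h => hva (hKG ⟨h, hvG⟩)
  obtain ⟨φ, hφv, hφK⟩ : ∃ φ : V x₀ →ₗ[k] k, φ v = 1 ∧ K ≤ LinearMap.ker φ := by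
    obtain ⟨φ, hφ, hK⟩ := Submodule.exists_le_ker_of_notMem hvK
    refine ⟨(φ v)⁻¹ • φ, inv_mul_cancel₀ hφ, fun x hx => ?_⟩
    rw [LinearMap.mem_ker, LinearMap.smul_apply, hK hx, smul_zero]
  -- The interval is JL ∪ JU. Over JL the vector v lifts compatibly, and over JU the functional φ
  -- extends compatibly.
  let JL : Set P := {x | ∃ h : x ≤ x₀, F₀ ≤ F x h}
  let JU : Set P := {y | ∃ h : x₀ ≤ y, ¬ G₀ ≤ G y h}
  have hL₀ : x₀ ∈ JL := ⟨le_rfl, fun w _ => ⟨w, hid _ _⟩⟩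
  have hU₀ : x₀ ∈ JU := ⟨le_rfl, fun h => hG₀a fun w hw => by
    have : w = 0 := by rw [← hid x₀ w]; exact h hw
    rw [this]
    exact zero_mem _⟩
  have hLdown : ∀ {x y}, x ≤ y → y ≤ x₀ → x ∈ JL → y ∈ JL := fun {x y} hxy hy ⟨h, hx⟩ =>
    ⟨hy, hx.trans (hFmono _ _ hxy _)⟩
  have hUup : ∀ {x y}, x ≤ y → x₀ ≤ x → y ∈ JU → x ∈ JU := fun {x y} hxy hx ⟨h, hy⟩ =>
    ⟨hx, fun h' => hy (h'.trans (hGmono _ _ hxy _))⟩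
  obtain ⟨ψ, hψ₀, hψ⟩ := exists_compatible_functionals η hid hcomp hU₀ (fun y hy => hy.1) φ
    (fun y hy w hw => hφK (hKa (hG₀min y hy.1 hy.2 hw)))
  obtain ⟨u, hu₀, hu⟩ := exists_compatible_vectors η hid hcomp hL₀ (fun y hy => hy.1) v
    (fun y hy => hy.2 hvF)
  -- On the whole interval Φ is compatible with the maps and so is w, with Φ x (w x) = 1, and both
  -- are zero outside. The idempotent is z ↦ Φ x (z) • w x.
  let Φ : ∀ x, V x →ₗ[k] k := fun x =>
    if x ∈ JU then ψ x else if h : x ≤ x₀ ∧ x ∈ JL then φ ∘ₗ η x x₀ h.1 else 0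
  let w : ∀ x, V x := fun x =>
    if x ∈ JL then u x else if h : x₀ ≤ x ∧ x ∈ JU then η x₀ x h.1 v else 0
  have hΦU : ∀ x (hx : x ∈ JU), Φ x = ψ x := fun x hx => if_pos hx
  have hΦL : ∀ x (hx : x ∈ JL) (z : V x), Φ x z = φ (η x x₀ hx.1 z) := fun x hx z => by
    by_cases hxU : x ∈ JU
    · obtain rfl : x = x₀ := le_antisymm hx.1 hxU.1
      rw [hΦU _ hxU, hψ₀, hid]
    · simp only [Φ, if_neg hxU, dif_pos (show x ≤ x₀ ∧ x ∈ JL from ⟨hx.1, hx⟩)]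
      rfl
  have hwL : ∀ x (hx : x ∈ JL), w x = u x := fun x hx => if_pos hx
  have hwU : ∀ x (hx : x ∈ JU), w x = η x₀ x hx.1 v := fun x hx => by
    by_cases hxL : x ∈ JL
    · obtain rfl : x = x₀ := le_antisymm hxL.1 hx.1
      rw [hwL _ hxL, hu₀, hid]
    · simp only [w, if_neg hxL, dif_pos (show x₀ ≤ x ∧ x ∈ JU from ⟨hx.1, hx⟩)]
  have hΦ0 : ∀ x, x ∉ JL → x ∉ JU → Φ x = 0 := fun x h₁ h₂ => by
    simp only [Φ, if_neg h₂, dif_neg (show ¬ (x ≤ x₀ ∧ x ∈ JL) from fun h => h₁ h.2)]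
  have hw0 : ∀ x, x ∉ JL → x ∉ JU → w x = 0 := fun x h₁ h₂ => by
    simp only [w, if_neg h₁, dif_neg (show ¬ (x₀ ≤ x ∧ x ∈ JU) from fun h => h₂ h.2)]
  have hwx₀ : ∀ x (h : x ≤ x₀), x ∈ JL → η x x₀ h (w x) = v := fun x h hx => by
    rw [hwL x hx, hu x hx x₀ hL₀, hu₀]
  have hwv : ∀ x (h : x₀ ≤ x), x ∉ JU → η x₀ x h v = 0 := fun x h hx => by
    by_contra hcon
    exact hx ⟨h, fun h' => hcon (h' hvG)⟩
  have hΦw : ∀ x, x ∈ JL ∨ x ∈ JU → Φ x (w x) = 1 := by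
    rintro x (hx | hx)
    · rw [hΦL x hx, hwx₀ x _ hx, hφv]
    · rw [hΦU x hx, hwU x hx, hψ x₀ hU₀ x hx, hψ₀, hφv]
  have hw_map : ∀ x y (h : x ≤ y), x ∈ JL ∨ x ∈ JU → η x y h (w x) = w y := by
    intro x y h hx
    rcases hx with hx | hx
    · rcases le_total y x₀ with hy | hy
      · have hyL := hLdown h hy hx
        rw [hwL x hx, hwL y hyL, hu x hx y hyL]
      · rw [← hcomp x x₀ y hx.1 hy, hwx₀ x _ hx]
        by_cases hyU : y ∈ JU
        · rw [hwU y hyU]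
        · rw [hwv y hy hyU]
          by_cases hyL : y ∈ JL
          · obtain rfl : y = x₀ := le_antisymm hyL.1 hy
            exact absurd hU₀ hyU
          · rw [hw0 y hyL hyU]
    · have hy := hx.1.trans h
      rw [hwU x hx, hcomp]
      by_cases hyU : y ∈ JU
      · rw [hwU y hyU]
      · rw [hwv y hy hyU]
        by_cases hyL : y ∈ JL
        · obtain rfl : y = x₀ := le_antisymm hyL.1 hy
          exact absurd hU₀ hyU
        · rw [hw0 y hyL hyU]
  have hΦ_map : ∀ x y (h : x ≤ y), y ∈ JL ∨ y ∈ JU → ∀ z, Φ y (η x y h z) = Φ x z := by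
    have hlow : ∀ x (h : x ≤ x₀) z, φ (η x x₀ h z) = Φ x z := by
      intro x h z
      by_cases hxL : x ∈ JL
      · rw [hΦL x hxL]
      · by_cases hxU : x ∈ JU
        · obtain rfl : x = x₀ := le_antisymm h hxU.1
          exact absurd hL₀ hxL
        · rw [hΦ0 x hxL hxU]
          exact hφK (hKF x h (fun h' => hxL ⟨h, h'⟩) ⟨z, rfl⟩)
    rintro x y h (hy | hy) z
    · rw [hΦL y hy, hcomp, hlow]
    · rcases le_total x x₀ with hx | hx
      · rw [← hcomp x x₀ y hx hy.1, hΦU y hy, hψ x₀ hU₀ y hy, hψ₀, hlow]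
      · have hxU := hUup h hx hy
        rw [hΦU y hy, hΦU x hxU, hψ x hxU y hy]
  refine ⟨fun x => (Φ x).smulRight (w x), fun x y h z => ?_, fun x z => ?_, fun x z => ?_,
    fun x z => ?_, fun h => ?_⟩
  · simp only [LinearMap.smulRight_apply, map_smul]
    by_cases hx : x ∈ JL ∨ x ∈ JU
    · by_cases hy : y ∈ JL ∨ y ∈ JU
      · rw [hw_map x y h hx, hΦ_map x y h hy]
      · rw [not_or] at hy
        rw [hw_map x y h hx, hw0 y hy.1 hy.2, smul_zero, smul_zero]
    · have hx' := not_or.1 hx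
      by_cases hy : y ∈ JL ∨ y ∈ JU
      · rw [hΦ_map x y h hy, hΦ0 x hx'.1 hx'.2, LinearMap.zero_apply, zero_smul, zero_smul]
      · rw [not_or] at hy
        rw [hw0 y hy.1 hy.2, hw0 x hx'.1 hx'.2, map_zero, smul_zero, smul_zero]
  · simp only [LinearMap.smulRight_apply, map_smul]
    by_cases hx : x ∈ JL ∨ x ∈ JU
    · rw [hΦw x hx, one_smul]
    · rw [not_or] at hx
      rw [hw0 x hx.1 hx.2, smul_zero, smul_zero]
  · rw [LinearMap.smulRight_apply]
    have : Φ x (a x z) = 0 ∨ w x = 0 := by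
      by_cases hx : x ∈ JL
      · left
        rw [hΦL x hx, ha]
        exact hφK (hKa ⟨z, rfl⟩)
      · by_cases hxU : x ∈ JU
        · left
          rw [← ha x₀ x hxU.1, hΦU x hxU, hψ x₀ hU₀ x hxU, hψ₀]
          exact hφK (hKa ⟨z, rfl⟩)
        · exact Or.inr (hw0 x hx hxU)
    rcases this with h | h <;> rw [h]
    · rw [zero_smul]
    · rw [smul_zero]
  · have hbw : b x (w x) = 0 := by
      by_cases hx : x ∈ JL
      · rw [← hb x x₀ hx.1, hwx₀ x _ hx]
        exact hG₀ hvG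
      · by_cases hxU : x ∈ JU
        · rw [hwU x hxU, hb]
          exact hG₀ hvG
        · rw [hw0 x hx hxU, map_zero]
    rw [LinearMap.smulRight_apply, map_smul, hbw, smul_zero]
  · have := LinearMap.congr_fun h v
    rw [LinearMap.smulRight_apply, hΦU x₀ hU₀, hψ₀, hφv, one_smul, hwL x₀ hL₀, hu₀] at this
    exact hva (this ▸ zero_mem _)

end LinearSystem

/-! ### Dimension criterion for transition maps along a thread -/

/-- If all kernels of the maps out of a system lie in the images of the maps into it, then a
transition map is bijective as soon as it does not change two dimensions. -/
theorem bijective_of_finrank_eq {k : Type*} [Field k] {V V' A B : Type*} [AddCommGroup V]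
    [Module k V] [AddCommGroup V'] [Module k V'] [AddCommGroup A] [Module k A] [AddCommGroup B]
    [Module k B] [FiniteDimensional k A] [FiniteDimensional k B]
    (η : V →ₗ[k] V') (a : A →ₗ[k] V) (a' : A →ₗ[k] V') (ha : ∀ v, η (a v) = a' v)
    (b : V →ₗ[k] B) (b' : V' →ₗ[k] B) (hb : ∀ v, b' (η v) = b v)
    (h : LinearMap.ker b ≤ LinearMap.range a) (h' : LinearMap.ker b' ≤ LinearMap.range a')
    (hr : Module.finrank k (LinearMap.range b) = Module.finrank k (LinearMap.range b'))
    (hk : Module.finrank k (LinearMap.ker a) = Module.finrank k (LinearMap.ker a')) :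
    Function.Bijective η := by
  have hr' : LinearMap.range b = LinearMap.range b' := Submodule.eq_of_le_of_finrank_eq (by
    rintro _ ⟨v, rfl⟩
    exact ⟨η v, hb v⟩) hr
  have hk' : LinearMap.ker a = LinearMap.ker a' := Submodule.eq_of_le_of_finrank_eq (by
    intro v hv
    rw [LinearMap.mem_ker] at hv ⊢
    rw [← ha, hv, map_zero]) hk
  -- A vector killed by η is killed by b, so it is a w with w in ker a' = ker a. For surjectivity, a
  -- preimage modulo ker b' is corrected by an element coming from A.
  constructor
  · refine (injective_iff_map_eq_zero η).2 fun v hv => ?_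
    have hv' : v ∈ LinearMap.ker b := by rw [LinearMap.mem_ker, ← hb, hv, map_zero]
    obtain ⟨w, rfl⟩ := h hv'
    rw [ha] at hv
    exact hk'.ge hv
  · intro v
    obtain ⟨v', hv'⟩ := hr'.ge ⟨v, rfl⟩
    have : v - η v' ∈ LinearMap.ker b' := by rw [LinearMap.mem_ker, map_sub, hb, hv', sub_self]
    obtain ⟨w, hw⟩ := h' this
    exact ⟨a w + v', by rw [map_add, ha, hw, sub_add_cancel]⟩

theorem finrank_range_le_of_factor {k : Type*} [Field k] {V V' B : Type*} [AddCommGroup V]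
    [Module k V] [AddCommGroup V'] [Module k V'] [AddCommGroup B]
    [Module k B] [FiniteDimensional k B] (η : V →ₗ[k] V') (b : V →ₗ[k] B) (b' : V' →ₗ[k] B)
    (hb : ∀ v, b' (η v) = b v) :
    Module.finrank k (LinearMap.range b) ≤ Module.finrank k (LinearMap.range b') :=
  Submodule.finrank_mono (by
    rintro _ ⟨v, rfl⟩
    exact ⟨η v, hb v⟩)

theorem finrank_ker_le_of_factor {k : Type*} [Field k] {V V' A : Type*} [AddCommGroup V]
    [Module k V] [AddCommGroup V'] [Module k V'] [AddCommGroup A]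
    [Module k A] [FiniteDimensional k A] (η : V →ₗ[k] V') (a : A →ₗ[k] V) (a' : A →ₗ[k] V')
    (ha : ∀ v, η (a v) = a' v) :
    Module.finrank k (LinearMap.ker a) ≤ Module.finrank k (LinearMap.ker a') :=
  Submodule.finrank_mono (fun v hv => by
    rw [LinearMap.mem_ker] at hv ⊢
    rw [← ha, hv, map_zero])

namespace ThreadQuiver

variable {T : ThreadQuiver.{u}} {k : Type u₁} [Field k] {I : CatIdeal k (PathCat k T)}

/-! ### Natural transformations between representations of the path category -/

theorem naturality_of_pathLike (M N : PwfRep.{w} k I.Quot) (t : ∀ X : T.Obj, val M X ⟶ val N X)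
    (ht : ∀ {X Y : T.Obj} (f : X ⟶ Y), act M f ≫ t Y = t X ≫ act N f) {X Y : T.Obj}
    (f : LinHom k X Y) :
    M.obj.map (I.proj.map f) ≫ t Y = t X ≫ N.obj.map (I.proj.map f) := by
  induction f using linHom_induction (T := T) with
  | zero => rw [Functor.map_zero, Functor.map_zero, Functor.map_zero, zero_comp, comp_zero]
  | add f g hf hg =>
    rw [Functor.map_add, Functor.map_add, Functor.map_add, Preadditive.add_comp,
      Preadditive.comp_add, hf, hg]
  | smul r g =>
    rw [Functor.map_smul, Functor.map_smul, Functor.map_smul, Linear.smul_comp,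
      Linear.comp_smul]
    exact congrArg (r • ·) (ht g)

/-- A family of linear maps that commutes with the action of all path-like elements is a morphism
of representations. -/
def natTransMk (M N : PwfRep.{w} k I.Quot) (t : ∀ X : T.Obj, val M X ⟶ val N X)
    (ht : ∀ {X Y : T.Obj} (f : X ⟶ Y), act M f ≫ t Y = t X ≫ act N f) : M.obj ⟶ N.obj where
  app X := t X.as
  naturality X Y f := by
    obtain ⟨f, rfl⟩ := I.proj.map_surjective f
    exact naturality_of_pathLike M N t ht f

/-! ### Threads of a noise free representation -/

variable (Z : PwfRep.{w} k I.Quot) {a b : T.V} (α : a ⟶ b)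

/-- The path-like element from the source of an arrow to a point of its thread. -/
def fromSource (x : T.P α) : Obj.vertex a ⟶ Obj.thread α x :=
  PathLike.through (X := .vertex a) (Y := .thread α x) Quiver.Path.nil

/-- The path-like element from a point of a thread to the target of the arrow. -/
def toTarget (x : T.P α) : Obj.thread α x ⟶ Obj.vertex b :=
  PathLike.through (X := .thread α x) (Y := .vertex b) Quiver.Path.nil

/-- With the dual factorization below, a thread communicates with the rest of the category only
through its source and target. Compatibility with all `through` elements reduces to two conditions
per point. -/
theorem through_eq_comp_fromSource {X : T.Obj} {y : T.P α}
    (p : Quiver.Path X.exit (Obj.thread α y).entry) :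
    (PathLike.through p : X ⟶ Obj.thread α y) =
      (PathLike.through (Y := .vertex a) p : X ⟶ Obj.vertex a) ≫ fromSource α y := by
  refine congrArg PathLike.through ?_
  exact (Quiver.Path.comp_nil _).symm

theorem through_eq_toTarget_comp {Y : T.Obj} {x : T.P α}
    (p : Quiver.Path (Obj.thread α x).exit Y.entry) :
    (PathLike.through p : Obj.thread α x ⟶ Y) =
      toTarget α x ≫ (PathLike.through (X := .vertex b) p : Obj.vertex b ⟶ Y) := by
  refine congrArg PathLike.through ?_
  exact ((Quiver.Path.nil_comp _).trans (Quiver.Path.nil_comp _)).symm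

open scoped Classical in
/-- The extension by zero of a family of endomorphisms on one thread. -/
def extendThread (e : ∀ x : T.P α, val Z (.thread α x) ⟶ val Z (.thread α x)) (X : T.Obj) :
    val Z X ⟶ val Z X :=
  if h : ∃ x : T.P α, Obj.thread α x = X then
    eqToHom (congrArg (val Z) h.choose_spec.symm) ≫ e h.choose ≫
      eqToHom (congrArg (val Z) h.choose_spec)
  else 0

theorem extendThread_thread (e : ∀ x : T.P α, val Z (.thread α x) ⟶ val Z (.thread α x))
    (x : T.P α) : extendThread Z α e (.thread α x) = e x := by
  have h : ∃ y : T.P α, Obj.thread α y = Obj.thread α x := ⟨x, rfl⟩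
  rw [extendThread, dif_pos h]
  have aux : ∀ (y : T.P α) (hy : Obj.thread α y = Obj.thread α x),
      eqToHom (congrArg (val Z) hy.symm) ≫ e y ≫ eqToHom (congrArg (val Z) hy) = e x := by
    intro y hy
    obtain rfl : y = x := by simpa using hy
    simp
  exact aux _ h.choose_spec

theorem extendThread_of_not (e : ∀ x : T.P α, val Z (.thread α x) ⟶ val Z (.thread α x))
    {X : T.Obj} (h : ¬ ∃ x : T.P α, Obj.thread α x = X) : extendThread Z α e X = 0 :=
  dif_neg h

/-- Any path-like element that is not an η inside a thread reaches the thread of α via its source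
and leaves via its target, so both composites vanish for it. -/
theorem extendThread_naturality (e : ∀ x : T.P α, val Z (.thread α x) ⟶ val Z (.thread α x))
    (he : ∀ x y (h : x ≤ y), actEta Z h ≫ e y = e x ≫ actEta Z h)
    (hin : ∀ x, act Z (fromSource α x) ≫ e x = 0) (hout : ∀ x, e x ≫ act Z (toTarget α x) = 0)
    {X Y : T.Obj} (f : X ⟶ Y) :
    act Z f ≫ extendThread Z α e Y = extendThread Z α e X ≫ act Z f := by
  rcases f with p | @⟨a', b', β, x, y, h⟩
  · have h₁ : act Z (PathLike.through p : X ⟶ Y) ≫ extendThread Z α e Y = 0 := by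
      by_cases hY : ∃ y : T.P α, Obj.thread α y = Y
      · obtain ⟨y, rfl⟩ := hY
        rw [extendThread_thread, through_eq_comp_fromSource, act_comp, Category.assoc, hin,
          comp_zero]
      · rw [extendThread_of_not Z α e hY, comp_zero]
    have h₂ : extendThread Z α e X ≫ act Z (PathLike.through p : X ⟶ Y) = 0 := by
      by_cases hX : ∃ x : T.P α, Obj.thread α x = X
      · obtain ⟨x, rfl⟩ := hX
        rw [extendThread_thread, through_eq_toTarget_comp, act_comp, reassoc_of% hout, zero_comp]
      · rw [extendThread_of_not Z α e hX, zero_comp]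
    rw [h₁, h₂]
  · by_cases hX : ∃ x' : T.P α, Obj.thread α x' = Obj.thread β x
    · obtain ⟨x', hx'⟩ := hX
      cases hx'
      rw [extendThread_thread, extendThread_thread]
      exact he _ y h
    · have hY : ¬ ∃ y' : T.P α, Obj.thread α y' = Obj.thread β y := by
        rintro ⟨y', hy'⟩
        cases hy'
        exact hX ⟨x, rfl⟩
      rw [extendThread_of_not Z α e hX, extendThread_of_not Z α e hY, zero_comp, comp_zero]

theorem actEta_fromSource {x y : T.P α} (h : x ≤ y) :
    act Z (fromSource α x) ≫ actEta Z h = act Z (fromSource α y) :=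
  (act_comp Z (fromSource α x) (PathLike.inside h : Obj.thread α x ⟶ Obj.thread α y)).symm

theorem actEta_toTarget {x y : T.P α} (h : x ≤ y) :
    actEta Z h ≫ act Z (toTarget α y) = act Z (toTarget α x) :=
  (act_comp Z (PathLike.inside h : Obj.thread α x ⟶ Obj.thread α y) (toTarget α y)).symm

theorem actEta_refl (x : T.P α) : actEta Z (le_refl x) = 𝟙 _ := by
  have : act Z (𝟙 (Obj.thread α x)) = 𝟙 _ := by
    rw [act, lin, CategoryTheory.Functor.map_id, CategoryTheory.Functor.map_id,
      CategoryTheory.Functor.map_id]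
  exact this

/-- In a noise free representation, whatever a thread does not send on comes from its source. -/
theorem ker_toTarget_le_range_fromSource {Z : PwfRep.{w} k I.Quot} (hZ : IsNoiseFree Z)
    (x₀ : T.P α) :
    LinearMap.ker (act Z (toTarget α x₀)).hom ≤ LinearMap.range (act Z (fromSource α x₀)).hom := by
  by_contra hcon
  -- A bad vector yields an interval summand of the thread, invisible at both ends. Extended by zero
  -- it is a noise summand of Z, hence zero, although e is non-zero at x₀.
  obtain ⟨e, he, hidem, hin, hout, hne⟩ := exists_idempotent_of_not_ker_le_range
    (V := fun x : T.P α => val Z (.thread α x)) (fun x y h => (actEta Z h).hom)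
    (fun x v => congrArg (fun f => f.hom v) (actEta_refl Z α x))
    (fun x y z h h' v => congrArg (fun f => f.hom v) (actEta_comp Z h h').symm)
    (fun x => (act Z (fromSource α x)).hom)
    (fun x y h v => congrArg (fun f => f.hom v) (actEta_fromSource Z α h))
    (fun x => (act Z (toTarget α x)).hom)
    (fun x y h v => congrArg (fun f => f.hom v) (actEta_toTarget Z α h)) x₀ hcon
  let e' : ∀ x : T.P α, val Z (.thread α x) ⟶ val Z (.thread α x) := fun x => ModuleCat.ofHom (e x)
  let ε : Z.obj ⟶ Z.obj := natTransMk Z Z (extendThread Z α e') (extendThread_naturality Z α e'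
    (fun x y h => ModuleCat.hom_ext (LinearMap.ext fun v => (he x y h v).symm))
    (fun x => ModuleCat.hom_ext (LinearMap.ext fun v => hin x v))
    (fun x => ModuleCat.hom_ext (LinearMap.ext fun v => hout x v)))
  have happ : ∀ X : I.Quot, ε.app X = extendThread Z α e' X.as := fun _ => rfl
  have hε : ε ≫ ε = ε := by
    ext X : 2
    rw [NatTrans.comp_app, happ]
    by_cases hX : ∃ x : T.P α, Obj.thread α x = X.as
    · obtain ⟨X⟩ := X
      obtain ⟨x, rfl⟩ := hX
      rw [extendThread_thread]
      exact ModuleCat.hom_ext (LinearMap.ext fun v => hidem x v)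
    · rw [extendThread_of_not Z α e' hX]
      exact zero_comp
  obtain ⟨N, i, p, hN, hip, hpi⟩ := Z.exists_isDirectSummand_of_idempotent ε hε
  have hnoise : IsNoise N := by
    intro v
    have h0 : ε.app (I.proj.obj ((Free.embedding k T.Obj).obj (.vertex v))) = 0 :=
      extendThread_of_not Z α e' (by rintro ⟨x, hx⟩; cases hx)
    refine (IsZero.iff_id_eq_zero _).2 ?_
    have h1 : i ≫ ε ≫ p = 𝟙 N.obj := by rw [← hpi, Category.assoc, hip, Category.comp_id, hip]
    have h2 := NatTrans.congr_app h1 (I.proj.obj ((Free.embedding k T.Obj).obj (.vertex v)))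
    rw [NatTrans.comp_app, NatTrans.comp_app, h0, zero_comp, comp_zero] at h2
    exact h2.symm
  have hzero := hZ N hN hnoise
  have hε0 : ε = 0 := by rw [← hpi, hzero.eq_of_tgt p 0, zero_comp]
  refine hne (LinearMap.ext fun v => ?_)
  have h3 := NatTrans.congr_app hε0 (I.proj.obj ((Free.embedding k T.Obj).obj (.thread α x₀)))
  rw [happ] at h3
  have h4 : e' x₀ = 0 := (extendThread_thread Z α e' x₀).symm.trans h3
  exact congrArg (fun f => f.hom v) h4

theorem sameCell_iff_of_le {x y : T.P α} (h : x ≤ y) :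
    SameCell Z (.thread α x) (.thread α y) ↔ ConstBetween Z x y := by
  refine ⟨fun hcell => ?_, .le α x y⟩
  cases hcell with
  | le _ _ _ hconst => exact hconst
  | ge _ _ _ hconst =>
    obtain rfl := le_antisymm h hconst.1
    exact hconst

/-- The partition induced by a noise free representation is valid. -/
theorem isValid_partition {Z : PwfRep.{w} k I.Quot} (hZ : IsNoiseFree Z) :
    IsValid (partition Z) where
  vertex v Y h := by
    cases h
    rfl
  thread α x Y h := by
    cases h with
    | le _ _ y _ => exact ⟨y, rfl⟩
    | ge _ _ y _ => exact ⟨y, rfl⟩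
  interval α x := by
    refine ⟨fun y hy z hz t ht => ?_⟩
    have hyz : SameCell Z (.thread α y) (.thread α z) :=
      (partition Z).trans ((partition Z).symm hy) hz
    rw [sameCell_iff_of_le Z α (ht.1.trans ht.2)] at hyz
    exact (partition Z).trans hy (.le α y t (constBetween_mono Z hyz le_rfl ht.1 ht.2))
  finite {a b} α := by
    -- The pair (r, s) determines the cell. Both grow along the thread, so equal values at two
    -- points force equal values in between, and every η in between is then bijective.
    let r : T.P α → ℕ := fun x => Module.finrank k (LinearMap.range (act Z (toTarget α x)).hom)
    let s : T.P α → ℕ := fun x => Module.finrank k (LinearMap.ker (act Z (fromSource α x)).hom)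
    have ha : ∀ {x y : T.P α} (h : x ≤ y) v, (actEta Z h).hom ((act Z (fromSource α x)).hom v) =
        (act Z (fromSource α y)).hom v := fun h v =>
      congrArg (fun f => f.hom v) (actEta_fromSource Z α h)
    have hb : ∀ {x y : T.P α} (h : x ≤ y) v, (act Z (toTarget α y)).hom ((actEta Z h).hom v) =
        (act Z (toTarget α x)).hom v := fun h v =>
      congrArg (fun f => f.hom v) (actEta_toTarget Z α h)
    have hr : Monotone r := fun x y h => finrank_range_le_of_factor (actEta Z h).hom _ _ (hb h)
    have hs : Monotone s := fun x y h => finrank_ker_le_of_factor (actEta Z h).hom _ _ (ha h)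
    have hiso : ∀ {x y : T.P α} (h : x ≤ y), r x = r y → s x = s y → IsIso (actEta Z h) := by
      intro x y h h₁ h₂
      refine (ConcreteCategory.isIso_iff_bijective (actEta Z h)).2 ?_
      exact bijective_of_finrank_eq (actEta Z h).hom _ _ (ha h) _ _ (hb h)
        (ker_toTarget_le_range_fromSource α hZ x) (ker_toTarget_le_range_fromSource α hZ y) h₁ h₂
    have hconst : ∀ {x y : T.P α}, x ≤ y → r x = r y → s x = s y → ConstBetween Z x y := by
      refine fun {x y} h h₁ h₂ => ⟨h, fun z hxz hzy => ⟨hiso _ ?_ ?_, hiso _ ?_ ?_⟩⟩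
      · exact le_antisymm (hr hxz) (h₁ ▸ hr hzy)
      · exact le_antisymm (hs hxz) (h₂ ▸ hs hzy)
      · exact le_antisymm (hr hzy) (h₁ ▸ hr hxz)
      · exact le_antisymm (hs hzy) (h₂ ▸ hs hxz)
    -- The values of r and s run from 0 up to the dimensions at the target and the source, whence
    -- the + 1.
    let c : Quotient ((partition Z).comap (Obj.thread α)) →
        Fin (Module.finrank k (val Z (.vertex b)) + 1) ×
          Fin (Module.finrank k (val Z (.vertex a)) + 1) := fun q =>
      ⟨⟨r q.out, Nat.lt_succ_of_le (Submodule.finrank_le _)⟩,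
        ⟨s q.out, Nat.lt_succ_of_le (Submodule.finrank_le _)⟩⟩
    refine Finite.of_injective c fun q q' h => ?_
    have h₁ : r q.out = r q'.out := congrArg (fun t => (t.1 : ℕ)) h
    have h₂ : s q.out = s q'.out := congrArg (fun t => (t.2 : ℕ)) h
    rw [← q.out_eq, ← q'.out_eq]
    refine Quotient.sound ?_
    change SameCell Z (.thread α q.out) (.thread α q'.out)
    rcases le_total q.out q'.out with hle | hle
    · exact .le α _ _ (hconst hle h₁ h₂)
    · exact .ge α _ _ (hconst hle h₁.symm h₂.symm)

end ThreadQuiver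

/-! ### Vanishing modulo an ideal, and direct sums up to isomorphism -/

theorem CatIdeal.proj_map_eq_zero {k : Type u₁} [Field k] {C : Type u₂} [Category.{v₁} C]
    [Preadditive C] [Linear k C] (I : CatIdeal k C) {X Y : C} {f : X ⟶ Y}
    (hf : f ∈ I.carrier X Y) : I.proj.map f = 0 := by
  rw [← Functor.map_zero I.proj]
  exact CategoryTheory.Quotient.sound _ (by simpa [CatIdeal.rel] using hf)

namespace PwfRep

variable {k : Type u₁} [Field k] {A : Type u₂} [Category.{v₁} A] [Preadditive A] [Linear k A]

theorem IsDirectSum.of_iso {Λ : Type u₃} {M : PwfRep.{w} k A} {V W : Λ → PwfRep.{w} k A}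
    (h : M.IsDirectSum W) (e : ∀ i, V i ≅ W i) : M.IsDirectSum V := by
  classical
  obtain ⟨ι, h⟩ := h
  refine ⟨fun i => (e i).hom ≫ ι i, fun X => ?_⟩
  let θ : ∀ i, (V i).obj.obj X →ₗ[k] (W i).obj.obj X := fun i => ((e i).hom.hom.app X).hom
  have hθ : ∀ i, Function.Bijective (θ i) := fun i => by
    have : IsIso (e i).hom.hom := inferInstanceAs (IsIso ((ObjectProperty.ι _).map (e i).hom))
    exact bijective_app_of_isIso (e i).hom.hom X
  have hcomp : DirectSum.toModule k Λ (M.obj.obj X)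
      (fun i => (((e i).hom ≫ ι i).hom.app X).hom) =
      (DirectSum.toModule k Λ (M.obj.obj X) fun i => ((ι i).hom.app X).hom) ∘ₗ
        DirectSum.lmap θ := by
    refine DirectSum.linearMap_ext _ fun i => ?_
    ext x
    rw [LinearMap.comp_apply, LinearMap.comp_apply, LinearMap.comp_apply, DirectSum.lmap_lof,
      DirectSum.toModule_lof, DirectSum.toModule_lof]
    rfl
  have hbij : Function.Bijective (DirectSum.lmap θ) :=
    ⟨(DirectSum.lmap_injective θ).2 fun i => (hθ i).1,
      (DirectSum.lmap_surjective θ).2 fun i => (hθ i).2⟩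
  have := (h X).comp hbij
  rw [← LinearMap.coe_comp] at this
  convert this using 2

end PwfRep

namespace ThreadQuiver

variable {T : ThreadQuiver.{u}}

/-! ### Uniqueness of the elements `η` -/

/-- Being one of the elements `η` within a thread. -/
def PathLike.IsInside : {X Y : T.Obj} → PathLike X Y → Prop
  | _, _, .through _ => False
  | _, _, .inside _ => True

theorem PathLike.IsInside.eq {X Y : T.Obj} {f g : PathLike X Y} (hf : f.IsInside)
    (hg : g.IsInside) : f = g := by
  cases f with
  | through p => exact hf.elim
  | inside h =>
    cases g with
    | through p => exact hg.elim
    | inside h' => rfl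

/-- The identity of a point of a thread is itself `inside le_rfl`, so only identities at vertices
remain as a separate case. -/
theorem IsEta.cases_inside {X Y : T.Obj} {f : X ⟶ Y} (hf : IsEta f) :
    (∃ v, X = .vertex v ∧ ∃ e : X = Y, f = eqToHom e) ∨ PathLike.IsInside f := by
  cases hf with
  | refl =>
    cases X with
    | vertex v => exact Or.inl ⟨v, rfl, rfl, rfl⟩
    | thread α x => exact Or.inr trivial
  | inside h => exact Or.inr trivial

theorem PathLike.IsInside.comp {X Y W : T.Obj} {f : PathLike X Y} {g : PathLike Y W}
    (hf : f.IsInside) (hg : g.IsInside) : (f.comp g).IsInside := by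
  cases f with
  | through p => exact hf.elim
  | inside h =>
    cases g with
    | through p => exact hg.elim
    | inside h' => trivial

theorem PathLike.IsInside.isEta {X Y : T.Obj} {f : PathLike X Y} (hf : f.IsInside) :
    IsEta (show X ⟶ Y from f) := by
  cases f with
  | through p => exact hf.elim
  | inside h => exact .inside h

theorem PathLike.not_isInside_vertex {v : T.V} {Y : T.Obj} (f : PathLike (.vertex v) Y) :
    ¬ f.IsInside := by
  cases f with
  | through p => exact fun h => h

/-- Together with closure under composition, this makes every diagram of η commute. -/
theorem IsEta.eq {X Y : T.Obj} {f g : X ⟶ Y} (hf : IsEta f) (hg : IsEta g) : f = g := by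
  rcases hf.cases_inside with ⟨v, rfl, e, he⟩ | hf'
  · rcases hg.cases_inside with ⟨-, -, e', he'⟩ | hg'
    · rw [he, he']
    · exact absurd hg' (PathLike.not_isInside_vertex g)
  · rcases hg.cases_inside with ⟨v, rfl, -⟩ | hg'
    · exact absurd hf' (PathLike.not_isInside_vertex f)
    · exact hf'.eq hg'

theorem IsEta.comp {X Y W : T.Obj} {f : X ⟶ Y} {g : Y ⟶ W} (hf : IsEta f) (hg : IsEta g) :
    IsEta (f ≫ g) := by
  cases hf with
  | refl => rwa [Category.id_comp]
  | inside h =>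
    rcases hg.cases_inside with ⟨v, hv, -⟩ | hg'
    · cases hv
    · exact (PathLike.IsInside.comp (f := .inside h) trivial hg').isEta

/-! ### Representations that are constant on cells -/

variable {k : Type u₁} [Field k] {I : CatIdeal k (PathCat k T)} {𝔓 : Setoid T.Obj} {S : Set T.Obj}

/-- The elements `η` within a cell act by isomorphisms. -/
def ConstOnCells (𝔓 : Setoid T.Obj) (W : PwfRep.{w} k I.Quot) : Prop :=
  ∀ ⦃X Y : T.Obj⦄ (a : X ⟶ Y), IsEta a → 𝔓 X Y → IsIso (act W a)

theorem constOnCells_partition (Z : PwfRep.{w} k I.Quot) : ConstOnCells (partition Z) Z := by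
  intro X Y a ha h
  cases ha with
  | refl => exact inferInstanceAs (IsIso (Z.obj.map (I.proj.map (lin k (𝟙 X)))))
  | inside hxy => exact (((sameCell_iff_of_le Z _ hxy).1 h).2 _ hxy le_rfl).1

/-- The inverse on Z, sandwiched between i and p, is an inverse on W by naturality. So every summand
of Z is constant on the cells of Z, even if its own partition is coarser. -/
theorem ConstOnCells.of_retract {Z W : PwfRep.{w} k I.Quot} (hZ : ConstOnCells 𝔓 Z)
    (i : W.obj ⟶ Z.obj) (p : Z.obj ⟶ W.obj) (hip : i ≫ p = 𝟙 W.obj) : ConstOnCells 𝔓 W := by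
  intro X Y a ha h
  have := hZ a ha h
  have hip' : ∀ X, i.app X ≫ p.app X = 𝟙 _ := fun X => NatTrans.congr_app hip X
  refine ⟨i.app _ ≫ inv (act Z a) ≫ p.app _, ?_, ?_⟩
  · rw [← Category.assoc, i.naturality, Category.assoc, IsIso.hom_inv_id_assoc, hip']
  · rw [Category.assoc, Category.assoc, ← p.naturality, IsIso.inv_hom_id_assoc, hip']

/-- In the equation defining equivalence, the side containing g acts by zero, and the η around f act
by isomorphisms and cancel. -/
theorem ConstOnCells.map_eq_zero_of_pEquiv {W : PwfRep.{w} k I.Quot} (hW : ConstOnCells 𝔓 W)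
    {X₁ Y₁ X₂ Y₂ : T.Obj} {f : LinHom k X₁ Y₁} {g : LinHom k X₂ Y₂} (h : PEquiv 𝔓 f g)
    (hg : g ∈ I.carrier X₂ Y₂) : W.obj.map (I.proj.map f) = 0 := by
  obtain ⟨-, -, Z', W', hZ', hW', a₁, a₂, b₁, b₂, ha₁, ha₂, hb₁, hb₂, H⟩ := h
  have i₁ : IsIso (W.obj.map (I.proj.map (lin k a₁))) := hW a₁ ha₁ hZ'
  have i₂ : IsIso (W.obj.map (I.proj.map (lin k b₁))) := hW b₁ hb₁ (𝔓.symm hW')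
  have hg0 : I.proj.map g = 0 := I.proj_map_eq_zero hg
  have H' := congrArg (fun f => W.obj.map (I.proj.map f)) H
  simp only [Functor.map_comp, hg0, Functor.map_zero, zero_comp, comp_zero] at H'
  rw [← cancel_epi (W.obj.map (I.proj.map (lin k a₁))),
    ← cancel_mono (W.obj.map (I.proj.map (lin k b₁))), Category.assoc, H', comp_zero, zero_comp]

/-- A representation that is constant on cells vanishes on the completion of the ideal. -/
theorem ConstOnCells.map_eq_zero {W : PwfRep.{w} k I.Quot} (hW : ConstOnCells 𝔓 W)
    {X Y : PathCat k T} {f : X ⟶ Y} (hf : f ∈ (completion 𝔓 I).carrier X Y) :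
    W.obj.map (I.proj.map f) = 0 := by
  let J : CatIdeal k (PathCat k T) :=
    { carrier := fun X Y =>
        { carrier := {f | W.obj.map (I.proj.map f) = 0}
          zero_mem' := by
            change W.obj.map (I.proj.map 0) = 0
            rw [Functor.map_zero, Functor.map_zero]
          add_mem' := fun {f g} hf hg => by
            change W.obj.map (I.proj.map (f + g)) = 0
            rw [Functor.map_add, Functor.map_add, hf, hg, add_zero]
          smul_mem' := fun r f hf => by
            change W.obj.map (I.proj.map (r • f)) = 0
            rw [Functor.map_smul, Functor.map_smul, hf, smul_zero] }
      comp_left := fun f g hg => by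
        change W.obj.map (I.proj.map (f ≫ g)) = 0
        rw [Functor.map_comp, Functor.map_comp, hg, comp_zero]
      comp_right := fun f g hf => by
        change W.obj.map (I.proj.map (f ≫ g)) = 0
        rw [Functor.map_comp, Functor.map_comp, hf, zero_comp] }
  -- The morphisms acting by zero on W form an ideal, so only the generators of the completion need
  -- checking.
  refine CatIdeal.mem_of_mem_generate hf J ?_
  rintro X Y f ⟨X', Y', g, hg, h⟩
  exact hW.map_eq_zero_of_pEquiv h hg

/-- A representation that is constant on cells, as a representation of the quotient by the
completion of the ideal. -/
def descend (W : PwfRep.{w} k I.Quot) (hW : ConstOnCells 𝔓 W) :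
    PwfRep.{w} k (completion 𝔓 I).Quot :=
  ⟨CategoryTheory.Quotient.lift _ (I.proj ⋙ W.obj) (fun X Y f g hfg => by
      have := hW.map_eq_zero hfg
      rw [Functor.map_sub, Functor.map_sub, sub_eq_zero] at this
      exact this), by
    refine ⟨⟨fun {X Y f g} => ?_⟩, ⟨fun {X Y} f r => ?_⟩, fun X =>
      inferInstanceAs (Module.Finite k (W.obj.obj (I.proj.obj X.as)))⟩
    · obtain ⟨f, rfl⟩ := (completion 𝔓 I).proj.map_surjective f
      obtain ⟨g, rfl⟩ := (completion 𝔓 I).proj.map_surjective g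
      rw [← Functor.map_add]
      exact (I.proj ⋙ W.obj).map_add
    · obtain ⟨f, rfl⟩ := (completion 𝔓 I).proj.map_surjective f
      rw [← Functor.map_smul]
      exact (I.proj ⋙ W.obj).map_smul r f⟩

/-- The restriction of a representation to the full subcategory on a set of objects. -/
def restrictSample (J : CatIdeal k (PathCat k T)) (S : Set T.Obj) :
    PwfRep.{w} k J.Quot ⥤ PwfRep.{w} k (sub J S) :=
  PwfRep.pullback (ObjectProperty.ι _)

/-- The representation of the full subcategory on a sample given by a representation that is
constant on cells. -/
def sampleRep (S : Set T.Obj) (W : PwfRep.{w} k I.Quot) (hW : ConstOnCells 𝔓 W) :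
    PwfRep.{w} k (sub (completion 𝔓 I) S) :=
  (restrictSample (completion 𝔓 I) S).obj (descend W hW)

theorem act_inflate_ind_sampleRep (h𝔓 : IsValid 𝔓) (hS : IsSample 𝔓 S) (W : PwfRep.{w} k I.Quot)
    (hW : ConstOnCells 𝔓 W) {X Y : T.Obj} (f : X ⟶ Y) :
    act ((inflate 𝔓 I).obj ((ind h𝔓 hS I).obj (sampleRep S W hW))) f =
      act W ((retractBasis h𝔓 hS).map f) :=
  congrArg (fun g => W.obj.map (I.proj.map g)) (retractHom_lin k h𝔓 hS f)

/-- X and its sample point are joined by an η in one direction or the other; τ is its action or the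
inverse. The two triangle identities characterize τ without mentioning the direction. -/
theorem exists_sampleTransition (h𝔓 : IsValid 𝔓) (hS : IsSample 𝔓 S) (W : PwfRep.{w} k I.Quot)
    (hW : ConstOnCells 𝔓 W) (X : T.Obj) :
    ∃ τ : val W ((retractBasis h𝔓 hS).obj X) ⟶ val W X, IsIso τ ∧
      (∀ (Y : T.Obj) (a₁ : Y ⟶ (retractBasis h𝔓 hS).obj X) (a₂ : Y ⟶ X), IsEta a₁ → IsEta a₂ →
        act W a₁ ≫ τ = act W a₂) ∧
      (∀ (Y : T.Obj) (b₁ : (retractBasis h𝔓 hS).obj X ⟶ Y) (b₂ : X ⟶ Y), IsEta b₁ → IsEta b₂ →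
        τ ≫ act W b₂ = act W b₁) := by
  have key : (∃ c : (retractBasis h𝔓 hS).obj X ⟶ X, IsEta c) ∨
      (∃ c : X ⟶ (retractBasis h𝔓 hS).obj X, IsEta c) := by
    rcases X with v | ⟨α, x⟩
    · exact Or.inl ⟨𝟙 _, .refl _⟩
    · rcases le_total (samplePt h𝔓 hS α x) x with h | h
      · exact Or.inl ⟨_, .inside h⟩
      · exact Or.inr ⟨_, .inside h⟩
  rcases key with ⟨c, hc⟩ | ⟨c, hc⟩
  · refine ⟨act W c, hW c hc (𝔓.symm (sampleObj_rel h𝔓 hS X)), fun Y a₁ a₂ h₁ h₂ => ?_,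
      fun Y b₁ b₂ h₁ h₂ => ?_⟩
    · rw [← act_comp, (h₁.comp hc).eq h₂]
    · rw [← act_comp, (hc.comp h₂).eq h₁]
  · have := hW c hc (sampleObj_rel h𝔓 hS X)
    refine ⟨inv (act W c), inferInstance, fun Y a₁ a₂ h₁ h₂ => ?_, fun Y b₁ b₂ h₁ h₂ => ?_⟩
    · rw [IsIso.comp_inv_eq, ← act_comp, (h₂.comp hc).eq h₁]
    · rw [IsIso.inv_comp_eq, ← act_comp, (hc.comp h₁).eq h₂]

/-- A representation that is constant on cells is induced from its restriction to a sample. -/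
theorem nonempty_inflate_ind_sampleRep_iso (h𝔓 : IsValid 𝔓) (hS : IsSample 𝔓 S)
    (W : PwfRep.{w} k I.Quot) (hW : ConstOnCells 𝔓 W) :
    Nonempty ((inflate 𝔓 I).obj ((ind h𝔓 hS I).obj (sampleRep S W hW)) ≅ W) := by
  choose τ hτ hτ₁ hτ₂ using exists_sampleTransition h𝔓 hS W hW
  have hnat : ∀ {X Y : T.Obj} (f : X ⟶ Y),
      act W ((retractBasis h𝔓 hS).map f) ≫ τ Y = τ X ≫ act W f := by
    intro X Y f
    -- The elements f and its retraction agree after composing with η from a common lower point and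
    -- to a common upper point. The triangle identities rewrite these η through τ, and the remaining
    -- isomorphisms cancel.
    obtain ⟨X', Y', hX', hY', a₁, a₂, b₁, b₂, ha₁, ha₂, hb₁, hb₂, H⟩ :=
      retractBasis_spec h𝔓 hS X Y
    have i₁ := hW a₁ ha₁ hX'
    have i₂ := hW b₂ hb₂ (𝔓.trans (sampleObj_rel h𝔓 hS Y) (𝔓.symm hY'))
    have H' := congrArg (act W) (H f)
    rw [act_comp, act_comp, act_comp, act_comp, ← hτ₁ X X' a₁ a₂ ha₁ ha₂,
      ← hτ₂ Y Y' b₁ b₂ hb₁ hb₂] at H'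
    rw [← cancel_epi (act W a₁), ← cancel_mono (act W b₂)]
    simpa only [Category.assoc] using H'
  let t : (((inflate 𝔓 I).obj ((ind h𝔓 hS I).obj (sampleRep S W hW))).obj ⟶ W.obj) :=
    natTransMk _ W τ fun {X Y} f =>
      (congrArg (· ≫ τ Y) (act_inflate_ind_sampleRep h𝔓 hS W hW f)).trans (hnat f)
  have : ∀ X, IsIso (t.app X) := fun X => hτ X.as
  have := NatIso.isIso_of_isIso_app t
  exact ⟨PwfRep.isoMk (asIso t)⟩

/-! ### Indecomposability over the sample -/

theorem sampleObj_eq_self (h𝔓 : IsValid 𝔓) (hS : IsSample 𝔓 S) {X : T.Obj} (hX : X ∈ S) :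
    sampleObj h𝔓 hS X = X :=
  (hS X).unique ⟨sampleObj_mem h𝔓 hS X, sampleObj_rel h𝔓 hS X⟩ ⟨hX, 𝔓.refl X⟩

theorem exists_retraction_obj_eq (h𝔓 : IsValid 𝔓) (hS : IsSample 𝔓 S)
    (I : CatIdeal k (PathCat k T)) (X : sub (completion 𝔓 I) S) :
    ∃ Y : I.Quot, (retraction h𝔓 hS I).obj ((toCompletion 𝔓 I).obj Y) = X := by
  obtain ⟨⟨X⟩, hX⟩ := X
  have e := sampleObj_eq_self h𝔓 hS (X := X) hX
  refine ⟨⟨X⟩, ObjectProperty.FullSubcategory.ext ?_⟩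
  exact congrArg (CategoryTheory.Quotient.mk (r := (completion 𝔓 I).rel)) e

/-- Induction from a sample detects indecomposables. -/
theorem isIndecomposable_of_inflate_ind (h𝔓 : IsValid 𝔓) (hS : IsSample 𝔓 S)
    (N : PwfRep.{w} k (sub (completion 𝔓 I) S))
    (h : ((inflate 𝔓 I).obj ((ind h𝔓 hS I).obj N)).IsIndecomposable) : N.IsIndecomposable := by
  rw [PwfRep.isIndecomposable_iff] at h ⊢
  obtain ⟨⟨X, hX⟩, H⟩ := h
  refine ⟨⟨_, hX⟩, fun e he => ?_⟩
  -- The components of e' are components of e, and all of them occur, because the retraction fixes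
  -- the sample points.
  let e' := ((inflate 𝔓 I).map ((ind h𝔓 hS I).map ⟨e⟩)).hom
  have happ : ∀ Y, e'.app Y = e.app ((retraction h𝔓 hS I).obj ((toCompletion 𝔓 I).obj Y)) :=
    fun _ => rfl
  have he' : e' ≫ e' = e' := by
    ext Y : 2
    exact NatTrans.congr_app he ((retraction h𝔓 hS I).obj ((toCompletion 𝔓 I).obj Y))
  refine (H e' he').imp (fun h0 => ?_) fun h1 => ?_
  · ext X : 2
    obtain ⟨Y, rfl⟩ := exists_retraction_obj_eq h𝔓 hS I X
    rw [← happ, h0]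
    rfl
  · ext X : 2
    obtain ⟨Y, rfl⟩ := exists_retraction_obj_eq h𝔓 hS I X
    rw [← happ, h1]
    rfl

end ThreadQuiver

end

/-! ### The decomposition theorem -/

theorem mainTheorem2 {k : Type u₁} [Field k] (T : ThreadQuiver.{u})
    (I : CatIdeal k (ThreadQuiver.PathCat k T))
    (Z : PwfRep.{w} k I.Quot) (hZ : ThreadQuiver.IsNoiseFree Z)
    (S : Set T.Obj) (hS : ThreadQuiver.IsSample (ThreadQuiver.partition Z) S) :
    ∃ h𝔓 : ThreadQuiver.IsValid (ThreadQuiver.partition Z),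
    ∃ (Λ : Type u)
      (N : Λ → PwfRep.{w} k
        (ThreadQuiver.sub (ThreadQuiver.completion (ThreadQuiver.partition Z) I) S)),
      (∀ i, (N i).IsIndecomposable) ∧
      (∀ i, ((ThreadQuiver.inflate (ThreadQuiver.partition Z) I).obj
        ((ThreadQuiver.ind h𝔓 hS I).obj (N i))).IsIndecomposable) ∧
      Z.IsDirectSum (fun i => (ThreadQuiver.inflate (ThreadQuiver.partition Z) I).obj
        ((ThreadQuiver.ind h𝔓 hS I).obj (N i))) ∧
      (∀ (Λ' : Type u₂) (V : Λ' → PwfRep.{w} k I.Quot),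
        (∀ j, (V j).IsIndecomposable) → Z.IsDirectSum V →
        ∃ σ : Λ ≃ Λ', ∀ i, Nonempty ((ThreadQuiver.inflate (ThreadQuiver.partition Z) I).obj
          ((ThreadQuiver.ind h𝔓 hS I).obj (N i)) ≅ V (σ i))) ∧
      (S.Finite → Finite Λ) := by
  have h𝔓 := ThreadQuiver.isValid_partition hZ
  obtain ⟨Λ, W, hW, ι, hι⟩ := Z.exists_isDirectSum_indecomposable
  have hconst : ∀ i, ThreadQuiver.ConstOnCells (ThreadQuiver.partition Z) (W i) := fun i =>
    (ThreadQuiver.constOnCells_partition Z).of_retract (ι i).hom (hι.π i) (hι.ι_π_self i)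
  have hiso := fun i =>
    (ThreadQuiver.nonempty_inflate_ind_sampleRep_iso h𝔓 hS (W i) (hconst i)).some
  have hind := fun i => PwfRep.isIndecomposable_of_iso (hiso i) (hW i)
  have hsum := PwfRep.IsDirectSum.of_iso ⟨ι, hι⟩ hiso
  refine ⟨h𝔓, Λ, fun i => ThreadQuiver.sampleRep S (W i) (hconst i),
    fun i => ThreadQuiver.isIndecomposable_of_inflate_ind h𝔓 hS _ (hind i), hind, hsum,
    fun Λ' V hV hV' => PwfRep.exists_equiv_of_isDirectSum hind hV hsum hV', fun hSfin => ?_⟩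
  -- An induced summand takes at X the value of `W i` at the sample point of X. Being non-zero, it
  -- is thus visible at some point of S, and each point sees finitely many summands.
  have hfin : (⋃ X ∈ S, {i | Nontrivial (ThreadQuiver.val (W i) X)}).Finite :=
    hSfin.biUnion fun X _ => hι.finite_support _
  refine Set.finite_univ_iff.1 (hfin.subset fun i _ => ?_)
  obtain ⟨⟨X, hX⟩, -⟩ := (PwfRep.isIndecomposable_iff _).1 (hind i)
  exact Set.mem_biUnion (ThreadQuiver.sampleObj_mem h𝔓 hS X.as) hX
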